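/- Let $\lambda,\lambda',\xi,\xi',\gamma,\rho,\mu,p,b,c,\sigma\in\mathbb{C}$ with $\sigma\neq0$, let $a\in\mathbb{N}$, let $\alpha>0$ and $x>0$ be real, and put $1/\Gamma=0$ at the poles of $\Gamma$. All powers of positive numbers are principal. Define: - the generalized Struve function $${}_a\mathcal{W}^{\alpha,\mu}_{p,b,c,\sigma}(z)=\sum_{k=0}^{\infty}\frac{(-c)^k}{\Gamma(\alpha k+\mu)\,\Gamma\!\left(ak+\frac p\sigma+\frac{b+2}{2}\right)}\left(\frac z2\right)^{2k+p+1};$$ - the Fox–Wright function $${}_m\Psi_n\!\left[\begin{matrix}(a_i,\alpha_i)_{1,m}\\(b_j,\beta_j)_{1,n}\end{matrix}\,\Big|\,z\right]=\sum_{k=0}^\infty\frac{\prod_{i=1}^m\Gamma(a_i+\alpha_ik)}{\prod_{j=1}^n\Gamma(b_j+\beta_jk)}\frac{z^k}{k!};$$ - for $\Re\gamma>0$, the left-sided Marichev–Saigo–Maeda fractional integral $$\left(I_{0+}^{\lambda,\lambda',\xi,\xi',\gamma}f\right)(x)=\frac{x^{-\lambda}}{\Gamma(\gamma)}\int_0^x(x-t)^{\gamma-1}t^{-\lambda'}F_3\!\left(\lambda,\lambda',\xi,\xi';\gamma;1-\frac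 tx,1-\frac xt\right)f(t)\,dt,$$ where $F_3(\lambda,\lambda',\xi,\xi';\gamma;u,v)=\sum_{m,n\ge0}\frac{(\lambda)_m(\lambda')_n(\xi)_m(\xi')_n}{(\gamma)_{m+n}\,m!\,n!}u^mv^n$ for $|u|,|v|<1$ is Appell's function, continued analytically in $v$ along the real half-line $v<1$. Assume $\Re\gamma>0$ and $$\Re(\rho+p+1)>\max\{0,\ \Re(\lambda+\lambda'+\xi-\gamma),\ \Re(\lambda'-\xi')\}.$$ Then the Struve series converges absolutely at every $t>0$, the integral defining the left-hand side below is absolutely convergent, the Fox–Wright series on the right converges absolutely, and $$\left(I_{0+}^{\lambda,\lambda',\xi,\xi',\gamma}\,t^{\rho-1}{}_a\mathcal{W}^{\alpha,\mu}_{p,b,c,\sigma}(t)\right)(x)=\frac{x^{\rho+p-\lambda-\lambda'+\gamma}}{2^{p+1}}\;{}_4\Psi_5\!\left[\begin{matrix}A\\B\end{matrix}\,\Big|\,-\frac{cx^2}{4}\right],$$ where $$A=(\rho+p+1,2),\ (\rho+p+1+\gamma-\lambda-\lambda'-\xi,2),\ (\rho+p+1+\xi'-\lambda',2),\ (1,1),$$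 $$B=(\rho+p+1+\xi',2),\ (\rho+p+1+\gamma-\lambda-\lambda',2),\ (\rho+p+1+\gamma-\lambda'-\xi,2),\ (\mu,\alpha),\ \left(\tfrac p\sigma+\tfrac{b+2}{2},a\right).$$ In particular, this holds with $\sigma=\xi$ when $\xi\neq0$. -/

import Mathlib

/-- The Appell double series
`F₃(a, a', b, b'; c; u, v) = ∑ (a)ₘ (a')ₙ (b)ₘ (b')ₙ / ((c)ₘ₊ₙ m! n!) uᵐ vⁿ`,
absolutely convergent for `|u| < 1`, `|v| < 1` (when `c` is not a non-positive integer). -/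
noncomputable def appellF3Series (a a' b b' c u v : ℂ) : ℂ :=
  ∑' q : ℕ × ℕ,
    ((ascPochhammer ℂ q.1).eval a * (ascPochhammer ℂ q.2).eval a' *
        (ascPochhammer ℂ q.1).eval b * (ascPochhammer ℂ q.2).eval b') /
      ((ascPochhammer ℂ (q.1 + q.2)).eval c * (q.1.factorial : ℂ) * (q.2.factorial : ℂ)) *
      u ^ q.1 * v ^ q.2

/-- `g` is the analytic continuation, along the real half-line `v < 1`, of the function
`v ↦ F₃(a, a', b, b'; c; u, v)` given by the double series for `-1 < v < 1`. -/
def IsAppellF3Continuation (a a' b b' c u : ℂ) (g : ℝ → ℂ) : Prop :=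
  AnalyticOnNhd ℝ g (Set.Iio 1) ∧
    ∀ v ∈ Set.Ioo (-1 : ℝ) 1, g v = appellF3Series a a' b b' c u (v : ℂ)

/-- The continuation is unique. -/
theorem IsAppellF3Continuation.eqOn {a a' b b' c u : ℂ} {g h : ℝ → ℂ}
    (hg : IsAppellF3Continuation a a' b b' c u g)
    (hh : IsAppellF3Continuation a a' b b' c u h) : Set.EqOn g h (Set.Iio 1) := by
  refine hg.1.eqOn_of_preconnected_of_eventuallyEq hh.1 isPreconnected_Iio
    (z₀ := 0) (by simp) ?_
  filter_upwards [Ioo_mem_nhds (show (-1 : ℝ) < 0 by norm_num) one_pos] with v hv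
  rw [hg.2 v hv, hh.2 v hv]

open Classical in
/-- The Appell function `F₃(a, a', b, b'; c; u, v)` for `|u| < 1` and real `v < 1`: the analytic
continuation in `v` of the double series. (It is the restriction to real `v` of the branch that
is holomorphic for `|u| < 1`, `v ∈ ℂ ∖ [1, ∞)`.) -/
noncomputable def appellF3 (a a' b b' c u : ℂ) (v : ℝ) : ℂ :=
  if h : ∃ g : ℝ → ℂ, IsAppellF3Continuation a a' b b' c u g then h.choose v else 0

/-- The integrand `(x - t)^(γ-1) t^(-λ') F₃(λ, λ', ξ, ξ'; γ; 1 - t/x, 1 - x/t) f(t)` of the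
left-sided Marichev–Saigo–Maeda integral. -/
noncomputable def msmIntegrand (lam lam' ξ ξ' γ : ℂ) (f : ℝ → ℂ) (x t : ℝ) : ℂ :=
  ((x - t : ℝ) : ℂ) ^ (γ - 1) * (t : ℂ) ^ (-lam') *
    appellF3 lam lam' ξ ξ' γ ((1 - t / x : ℝ) : ℂ) (1 - x / t) * f t

/-- The left-sided Marichev–Saigo–Maeda fractional integral of `f` at `x > 0`. -/
noncomputable def msmIntegral (lam lam' ξ ξ' γ : ℂ) (f : ℝ → ℂ) (x : ℝ) : ℂ :=
  (x : ℂ) ^ (-lam) / Complex.Gamma γ *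
    ∫ t in (0 : ℝ)..x, msmIntegrand lam lam' ξ ξ' γ f x t

/-- The `k`-th term of the generalized Struve series. Division by a value of `Complex.Gamma` at
a pole gives `0`, which is the usual convention `1 / Γ = 0` there. -/
noncomputable def struveTerm (a : ℕ) (α : ℝ) (μ p b c σ z : ℂ) (k : ℕ) : ℂ :=
  (-c) ^ k / (Complex.Gamma ((α : ℂ) * k + μ) *
      Complex.Gamma ((a : ℂ) * k + p / σ + (b + 2) / 2)) *
    (z / 2) ^ (2 * (k : ℂ) + p + 1)

/-- The generalized Struve function `ₐW^{α,μ}_{p,b,c,σ}(z)`, with principal powers. -/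
noncomputable def generalizedStruve (a : ℕ) (α : ℝ) (μ p b c σ z : ℂ) : ℂ :=
  ∑' k : ℕ, struveTerm a α μ p b c σ z k

/-- The `k`-th term of the Fox–Wright series with upper pairs `A i = (aᵢ, αᵢ)` and lower pairs
`B j = (bⱼ, βⱼ)`. -/
noncomputable def foxWrightTerm {m n : ℕ} (A : Fin m → ℂ × ℝ) (B : Fin n → ℂ × ℝ) (z : ℂ)
    (k : ℕ) : ℂ :=
  (∏ i, Complex.Gamma ((A i).1 + ((A i).2 : ℂ) * k)) /
    (∏ j, Complex.Gamma ((B j).1 + ((B j).2 : ℂ) * k)) * (z ^ k / (k.factorial : ℂ))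

/-- The Fox–Wright function `ₘΨₙ[A; B | z]`. -/
noncomputable def foxWright {m n : ℕ} (A : Fin m → ℂ × ℝ) (B : Fin n → ℂ × ℝ) (z : ℂ) : ℂ :=
  ∑' k : ℕ, foxWrightTerm A B z k

/-- The upper parameters of the `₄Ψ₅` in the image formula. -/
def imageUpper (lam lam' ξ ξ' γ ρ p : ℂ) : Fin 4 → ℂ × ℝ :=
  ![(ρ + p + 1, 2), (ρ + p + 1 + γ - lam - lam' - ξ, 2), (ρ + p + 1 + ξ' - lam', 2), (1, 1)]

/-- The lower parameters of the `₄Ψ₅` in the image formula. -/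
noncomputable def imageLower (lam lam' ξ ξ' γ ρ : ℂ) (a : ℕ) (α : ℝ) (μ p b σ : ℂ) :
    Fin 5 → ℂ × ℝ :=
  ![(ρ + p + 1 + ξ', 2), (ρ + p + 1 + γ - lam - lam', 2), (ρ + p + 1 + γ - lam' - ξ, 2),
    (μ, α), (p / σ + (b + 2) / 2, (a : ℝ))]

open Filter Topology MeasureTheory
open scoped Nat

/-! The kernel becomes tractable after Pfaff's transformation in the second variable of F₃. Since v
↦ v/(v-1) sends 1 - x/t to 1 - t/x, both variables of the transformed double series equal u = 1 -
t/x. The prefactor (1-v)^(-λ') = (x/t)^(-λ') turns t^(-λ') into x^(-λ'). So on (0, x) the kernel is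
a power of x - t times a one-variable series `pfaffDiag` in u (`msmIntegrand_eq`), which also
replaces the analytic continuation by something explicit (`appellF3_eq_pfaff`).

For f(t) = t^(s-1), the substitution u = 1 - t/x leaves the integral of u^(γ-1) (1-u)^(s-1) Σ dₘₙ
u^(m+n) over (0, 1). Termwise integration gives beta values B(γ+m+n, s), and the double sum
collapses under two applications of Gauss's theorem (`tsum_gaussTerm`), first in n and then in m, to
a quotient of six Gammas (`tsum_pfaffCoeff_mul_betaIntegral`). The termwise step is justified for Re
λ' > 0. The general case follows by induction from a contiguous relation that raises λ' and leaves
the two other convergence conditions unchanged (`pfaffDiag_contiguous`, `gammaQuotient_contiguous`).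

The Struve function is a series of powers with s = ρ + p + 1 + 2k. Its coefficients decay fast
enough, thanks to 1/Γ(αk + μ) with α > 0, for sum and integral to be interchanged, and the Gamma
quotients at these s are the Fox–Wright coefficients (`foxWrightTerm_image_eq`). -/

/-! ### Rising factorials: recurrences, growth, Chu–Vandermonde. -/

/-- The rising factorial `(z)ₙ = z (z + 1) ⋯ (z + n - 1)`. -/
noncomputable def rising (z : ℂ) (n : ℕ) : ℂ := (ascPochhammer ℂ n).eval z

@[simp] theorem rising_zero (z : ℂ) : rising z 0 = 1 := by simp [rising]

theorem rising_succ (z : ℂ) (n : ℕ) : rising z (n + 1) = rising z n * (z + n) :=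
  ascPochhammer_succ_eval n z

theorem rising_add (z : ℂ) (m n : ℕ) : rising z (m + n) = rising z m * rising (z + m) n := by
  induction n with
  | zero => simp
  | succ n ih => rw [← add_assoc, rising_succ, ih, rising_succ]; push_cast; ring

theorem rising_succ_left (z : ℂ) (n : ℕ) : rising z (n + 1) = z * rising (z + 1) n := by
  rw [add_comm, rising_add]; simp [rising]

theorem add_natCast_ne_zero {z : ℂ} (hz : 0 < z.re) (n : ℕ) : z + n ≠ 0 := by
  intro h
  have := congrArg Complex.re h
  simp at this
  have : (0 : ℝ) ≤ n := n.cast_nonneg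
  linarith

theorem rising_ne_zero {z : ℂ} (hz : 0 < z.re) (n : ℕ) : rising z n ≠ 0 := by
  induction n with
  | zero => simp
  | succ n ih => rw [rising_succ]; exact mul_ne_zero ih (add_natCast_ne_zero hz n)

theorem rising_eq_prod (z : ℂ) (n : ℕ) : rising z n = ∏ j ∈ Finset.range n, (z + j) := by
  induction n with
  | zero => simp
  | succ n ih => rw [rising_succ, ih, Finset.prod_range_succ]

theorem inv_Gamma_eq_rising_mul (z : ℂ) (n : ℕ) :
    (Complex.Gamma z)⁻¹ = rising z n * (Complex.Gamma (z + n))⁻¹ := by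
  induction n with
  | zero => simp
  | succ n ih =>
    rw [ih, Complex.one_div_Gamma_eq_self_mul_one_div_Gamma_add_one, rising_succ]
    push_cast
    ring_nf

theorem Gamma_add_nat {z : ℂ} (hz : 0 < z.re) (n : ℕ) :
    Complex.Gamma (z + n) = rising z n * Complex.Gamma z := by
  have h := inv_Gamma_eq_rising_mul z n
  have h1 : Complex.Gamma z ≠ 0 := Complex.Gamma_ne_zero_of_re_pos hz
  have h2 : Complex.Gamma (z + n) ≠ 0 := by
    refine Complex.Gamma_ne_zero_of_re_pos ?_
    have : (0 : ℝ) ≤ n := n.cast_nonneg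
    simp; linarith
  field_simp at h
  rw [h]; ring

/-- The normalized modulus of a rising factorial converges. -/
theorem tendsto_norm_rising_div (z : ℂ) :
    Tendsto (fun n : ℕ => ‖rising z n‖ / (n ! * ((n : ℝ) + 1) ^ (z.re - 1))) atTop
      (𝓝 ‖(Complex.Gamma z)⁻¹‖) := by
  -- `Complex.Gamma` takes the value 0 exactly at its poles z = -k. There the factor z + k
  -- annihilates the rising factorial for n > k, matching the limit 0.
  by_cases hz : Complex.Gamma z = 0
  · obtain ⟨k, hk⟩ := (Complex.Gamma_eq_zero_iff z).1 hz
    rw [hz]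
    refine tendsto_const_nhds.congr' ?_
    filter_upwards [eventually_gt_atTop k] with n hn
    have : rising z n = 0 := by
      rw [rising_eq_prod, Finset.prod_eq_zero (i := k) (by simpa using hn)]
      rw [hk]; ring
    simp [this]
  -- Away from the poles this is Euler's limit n^z n!/(z)ₙ₊₁ → Γ(z), inverted. The factors `h2` and
  -- `h3` convert n to n + 1 and remove the extra factor z + n of (z)ₙ₊₁.
  have h1 : Tendsto (fun n : ℕ => ‖(Complex.GammaSeq z n)⁻¹‖) atTop
      (𝓝 ‖(Complex.Gamma z)⁻¹‖) :=
    ((Complex.GammaSeq_tendsto_Gamma z).inv₀ hz).norm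
  have hratio : Tendsto (fun n : ℕ => (n : ℝ) / ((n : ℝ) + 1)) atTop (𝓝 1) := by
    simpa using tendsto_natCast_div_add_atTop (𝕜 := ℝ) 1
  have h2 : Tendsto (fun n : ℕ => ((n : ℝ) / ((n : ℝ) + 1)) ^ z.re) atTop (𝓝 1) := by
    simpa using hratio.rpow_const (p := z.re) (Or.inl one_ne_zero)
  have h3 : Tendsto (fun n : ℕ => ‖(z + n) / ((n : ℂ) + 1)‖) atTop (𝓝 1) := by
    have ha : Tendsto (fun n : ℕ => (n : ℂ) / ((n : ℂ) + 1)) atTop (𝓝 1) :=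
      tendsto_natCast_div_add_atTop (𝕜 := ℂ) 1
    have hb : Tendsto (fun n : ℕ => z / ((n : ℂ) + 1)) atTop (𝓝 0) := by
      rw [tendsto_zero_iff_norm_tendsto_zero]
      have := (tendsto_one_div_add_atTop_nhds_zero_nat (𝕜 := ℝ)).const_mul ‖z‖
      rw [mul_zero] at this
      refine this.congr fun n => ?_
      rw [norm_div, show ((n : ℂ) + 1) = ((n + 1 : ℕ) : ℂ) by push_cast; rfl, Complex.norm_natCast]
      push_cast; ring
    have := (hb.add ha).norm
    simp only [zero_add, norm_one] at this
    refine this.congr fun n => ?_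
    rw [← add_div]
  have h4 := (h1.mul h2).div h3 one_ne_zero
  simp only [mul_one, div_one] at h4
  refine h4.congr' ?_
  obtain ⟨N, hN⟩ := exists_nat_gt ‖z‖
  filter_upwards [eventually_gt_atTop 0, eventually_ge_atTop N] with n hn hnN
  have hn0 : (0 : ℝ) < n := by exact_mod_cast hn
  have hzn : z + n ≠ 0 := by
    intro h
    have : z = -(n : ℂ) := by linear_combination h
    rw [this, norm_neg, Complex.norm_natCast] at hN
    have : (N : ℝ) ≤ n := by exact_mod_cast hnN
    linarith
  have hp : (n : ℝ) ^ z.re ≠ 0 := (Real.rpow_pos_of_pos hn0 _).ne'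
  have hq : ((n : ℝ) + 1) ^ z.re ≠ 0 := (Real.rpow_pos_of_pos (by linarith) _).ne'
  have hf : (n ! : ℝ) ≠ 0 := by exact_mod_cast n.factorial_ne_zero
  have hzn' : ‖z + n‖ ≠ 0 := norm_ne_zero_iff.2 hzn
  have hc : ‖(n : ℂ) + 1‖ = (n : ℝ) + 1 := by
    rw [show ((n : ℂ) + 1) = ((n + 1 : ℕ) : ℂ) by push_cast; rfl, Complex.norm_natCast]
    push_cast; ring
  have hn1 : (n : ℝ) + 1 ≠ 0 := by positivity
  have hseq : Complex.GammaSeq z n = (n : ℂ) ^ z * n ! / (rising z n * (z + n)) := by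
    rw [← rising_succ, rising_eq_prod]; rfl
  rw [Pi.div_apply, hseq, norm_inv, norm_div, norm_mul, norm_mul,
    norm_div, hc, Complex.norm_natCast, Complex.norm_natCast_cpow_of_pos hn,
    Real.div_rpow hn0.le (by linarith), Real.rpow_sub_one hn1]
  field_simp

theorem norm_rising_le (z : ℂ) :
    ∃ C : ℝ, 0 < C ∧ ∀ n : ℕ, ‖rising z n‖ ≤ C * (n ! * ((n : ℝ) + 1) ^ (z.re - 1)) := by
  obtain ⟨C, hC⟩ := (tendsto_norm_rising_div z).bddAbove_range
  refine ⟨max C 1, by positivity, fun n => ?_⟩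
  have h := hC ⟨n, rfl⟩
  have hp : 0 < (n ! : ℝ) * ((n : ℝ) + 1) ^ (z.re - 1) := by positivity
  rw [div_le_iff₀ hp] at h
  exact h.trans (by gcongr; exact le_max_left _ _)

theorem le_norm_rising {z : ℂ} (hz : 0 < z.re) :
    ∃ C : ℝ, 0 < C ∧ ∀ n : ℕ, n ! * ((n : ℝ) + 1) ^ (z.re - 1) ≤ C * ‖rising z n‖ := by
  have hG : ‖(Complex.Gamma z)⁻¹‖ ≠ 0 := by
    simpa using Complex.Gamma_ne_zero_of_re_pos hz
  obtain ⟨C, hC⟩ := ((tendsto_norm_rising_div z).inv₀ hG).bddAbove_range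
  refine ⟨max C 1, by positivity, fun n => ?_⟩
  have h := hC ⟨n, rfl⟩
  have hp : 0 < ‖rising z n‖ := norm_pos_iff.2 (rising_ne_zero hz n)
  simp only [inv_div] at h
  rw [div_le_iff₀ hp] at h
  exact h.trans (by gcongr; exact le_max_left _ _)

theorem natCast_add_one_rpow_le (r : ℝ) :
    ∃ C : ℝ, 0 < C ∧ ∀ n : ℕ, ((n : ℝ) + 2) ^ r ≤ C * ((n : ℝ) + 1) ^ r := by
  refine ⟨max 1 (2 ^ r), by positivity, fun n => ?_⟩
  have hn : (0 : ℝ) ≤ n := n.cast_nonneg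
  have h1 : (0 : ℝ) < (n : ℝ) + 1 := by linarith
  have hq : ((n : ℝ) + 2) ^ r = (((n : ℝ) + 2) / (n + 1)) ^ r * ((n : ℝ) + 1) ^ r := by
    rw [Real.div_rpow (by linarith) h1.le, div_mul_cancel₀]
    exact (Real.rpow_pos_of_pos h1 _).ne'
  rw [hq]
  gcongr
  have hle : ((n : ℝ) + 2) / (n + 1) ≤ 2 := by rw [div_le_iff₀ h1]; linarith
  have hge : 1 ≤ ((n : ℝ) + 2) / (n + 1) := by rw [le_div_iff₀ h1]; linarith
  rcases le_total 0 r with hr | hr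
  · exact (Real.rpow_le_rpow (by linarith) hle hr).trans (le_max_right _ _)
  · exact (Real.rpow_le_one_of_one_le_of_nonpos hge hr).trans (le_max_left _ _)

/-- For Re z > 0 this is the quotient (z)ₘ₊ₙ/(z)ₘ with two-sided bounds. For other z the denominator
may vanish, so z is shifted to z + 1 and m to m - 1 by induction, with m = 0 handled by the
one-variable bound. Uniformity in m and n together is what the coefficients (γ - ξ' + m)ₙ require.
-/
theorem norm_rising_add_nat_le (z : ℂ) :
    ∃ C : ℝ, 0 < C ∧ ∀ m n : ℕ, ‖rising (z + m) n‖ ≤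
      C * (((m + n)! : ℝ) / m ! *
        (((m : ℝ) + n + 1) ^ (z.re - 1) / ((m : ℝ) + 1) ^ (z.re - 1))) := by
  obtain ⟨k, hk⟩ := exists_nat_gt (-z.re)
  have hk : 0 < z.re + k := by linarith
  induction k generalizing z with
  | zero =>
    have hz : 0 < z.re := by simpa using hk
    obtain ⟨C, hC, h1⟩ := norm_rising_le z
    obtain ⟨D, hD, h2⟩ := le_norm_rising hz
    refine ⟨C * D, by positivity, fun m n => ?_⟩
    have hm := h2 m
    have hmn := h1 (m + n)
    have hr : 0 < ‖rising z m‖ := norm_pos_iff.2 (rising_ne_zero hz m)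
    rw [rising_add, norm_mul] at hmn
    have hp1 : (0 : ℝ) < ((m : ℝ) + 1) ^ (z.re - 1) := by positivity
    have hf : (0 : ℝ) < m ! := by exact_mod_cast m.factorial_pos
    push_cast at hmn
    have : ‖rising (z + m) n‖ * (m ! * ((m : ℝ) + 1) ^ (z.re - 1)) ≤
        D * (C * ((m + n)! * ((m : ℝ) + n + 1) ^ (z.re - 1))) :=
      calc _ ≤ ‖rising (z + m) n‖ * (D * ‖rising z m‖) := by gcongr
        _ = D * (‖rising z m‖ * ‖rising (z + m) n‖) := by ring
        _ ≤ _ := by gcongr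
    rw [← le_div_iff₀ (by positivity)] at this
    refine this.trans (le_of_eq ?_)
    field_simp
  | succ k ih =>
    obtain ⟨C, hC, h1⟩ := ih (z + 1) (by push_cast at hk; simp; linarith) (by
      push_cast at hk; simp; linarith)
    obtain ⟨D, hD, h2⟩ := norm_rising_le z
    obtain ⟨E, hE, h3⟩ := natCast_add_one_rpow_le (z.re - 1)
    obtain ⟨F, hF, h4⟩ := natCast_add_one_rpow_le (-(z.re - 1))
    refine ⟨max (C * E * F) D, by positivity, fun m n => ?_⟩
    rcases m with _ | m
    · have := h2 n
      simp only [Nat.cast_zero, add_zero, zero_add, Nat.factorial_zero, Nat.cast_one, div_one,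
        Real.one_rpow]
      exact this.trans (by gcongr; exact le_max_right _ _)
    · have h := h1 m n
      have hz : z + ((m + 1 : ℕ) : ℂ) = z + 1 + m := by push_cast; ring
      rw [hz]
      refine h.trans ?_
      refine le_trans ?_ (mul_le_mul_of_nonneg_right (le_max_left _ _) (by positivity))
      have e1 := h3 m
      have e2 := h4 (m + n)
      have hp : (0 : ℝ) < (m : ℝ) + n + 1 := by positivity
      have hp2 : (0 : ℝ) < (m : ℝ) + n + 2 := by positivity
      have hm1 : (0 : ℝ) < (m : ℝ) + 1 := by positivity
      have hm2 : (0 : ℝ) < (m : ℝ) + 2 := by positivity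
      push_cast at e2
      rw [Real.rpow_neg hp2.le, Real.rpow_neg hp.le] at e2
      have e3 : ((m : ℝ) + n + 1) ^ (z.re - 1) ≤ F * ((m : ℝ) + n + 2) ^ (z.re - 1) := by
        have q1 := Real.rpow_pos_of_pos hp (z.re - 1)
        have q2 := Real.rpow_pos_of_pos hp2 (z.re - 1)
        field_simp at e2
        linarith
      have e4 : 1 / ((m : ℝ) + 1) ^ (z.re - 1) ≤ E * (1 / ((m : ℝ) + 2) ^ (z.re - 1)) := by
        have q1 := Real.rpow_pos_of_pos hm1 (z.re - 1)
        have q2 := Real.rpow_pos_of_pos hm2 (z.re - 1)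
        field_simp
        linarith
      have hfac : (((m + 1 + n)! : ℕ) : ℝ) = ((m : ℝ) + n + 1) * (m + n)! := by
        rw [show m + 1 + n = (m + n) + 1 by ring, Nat.factorial_succ]; push_cast; ring
      have hfac2 : (((m + 1)! : ℕ) : ℝ) = ((m : ℝ) + 1) * m ! := by
        rw [Nat.factorial_succ]; push_cast; ring
      have r1 : ((m : ℝ) + n + 1) ^ (z.re + 1 - 1) =
          ((m : ℝ) + n + 1) ^ (z.re - 1) * ((m : ℝ) + n + 1) := by
        rw [← Real.rpow_add_one hp.ne']; ring_nf
      have r2 : ((m : ℝ) + 1) ^ (z.re + 1 - 1) =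
          ((m : ℝ) + 1) ^ (z.re - 1) * ((m : ℝ) + 1) := by
        rw [← Real.rpow_add_one hm1.ne']; ring_nf
      rw [hfac, hfac2, Complex.add_re, Complex.one_re, r1, r2]
      push_cast
      rw [show (m : ℝ) + 1 + n + 1 = m + n + 2 by ring, show (m : ℝ) + 1 + 1 = m + 2 by ring]
      calc C * (((m + n)! : ℝ) / m ! * (((m : ℝ) + n + 1) ^ (z.re - 1) * ((m : ℝ) + n + 1) /
              (((m : ℝ) + 1) ^ (z.re - 1) * ((m : ℝ) + 1))))
          = C * (((m + n)! : ℝ) / m ! * (((m : ℝ) + n + 1) / ((m : ℝ) + 1))) *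
              (((m : ℝ) + n + 1) ^ (z.re - 1) * (1 / ((m : ℝ) + 1) ^ (z.re - 1))) := by
            field_simp
        _ ≤ C * (((m + n)! : ℝ) / m ! * (((m : ℝ) + n + 1) / ((m : ℝ) + 1))) *
              ((F * ((m : ℝ) + n + 2) ^ (z.re - 1)) *
                (E * (1 / ((m : ℝ) + 2) ^ (z.re - 1)))) := by gcongr
        _ = _ := by field_simp

/-- The Chu–Vandermonde identity. -/
theorem sum_antidiagonal_rising (N : ℕ) (a c : ℂ) :
    ∑ q ∈ Finset.HasAntidiagonal.antidiagonal N,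
      (N.choose q.1 : ℂ) * ((-1) ^ q.1 * rising a q.1 * rising (c + q.1) q.2) =
      rising (c - a) N := by
  induction N generalizing a c with
  | zero => simp
  | succ N ih =>
    -- Pascal's rule gives two copies of the induction hypothesis, at (a, c) with factor c + N and
    -- at (a + 1, c + 1) with factor -a. Both have the same value of c - a.
    rw [Finset.sum_antidiagonal_choose_succ_mul
      (fun i j => (-1) ^ i * rising a i * rising (c + i) j)]
    have h1 : ∀ q ∈ Finset.HasAntidiagonal.antidiagonal N,
        (N.choose q.1 : ℂ) * ((-1) ^ q.1 * rising a q.1 * rising (c + q.1) (q.2 + 1)) =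
        (c + N) * ((N.choose q.1 : ℂ) * ((-1) ^ q.1 * rising a q.1 * rising (c + q.1) q.2)) := by
      intro q hq
      have : (N : ℂ) = q.1 + q.2 := by rw [← Finset.HasAntidiagonal.mem_antidiagonal.1 hq]; push_cast; rfl
      rw [rising_succ, this]; ring
    have h2 : ∀ q ∈ Finset.HasAntidiagonal.antidiagonal N,
        (N.choose q.2 : ℂ) * ((-1) ^ (q.1 + 1) * rising a (q.1 + 1) *
          rising (c + (q.1 + 1 : ℕ)) q.2) =
        -a * ((N.choose q.1 : ℂ) * ((-1) ^ q.1 * rising (a + 1) q.1 *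
          rising (c + 1 + q.1) q.2)) := by
      intro q hq
      rw [rising_succ_left, Nat.choose_symm_of_eq_add (Finset.HasAntidiagonal.mem_antidiagonal.1 hq).symm]
      rw [show c + ((q.1 + 1 : ℕ) : ℂ) = c + 1 + q.1 by push_cast; ring]
      ring
    rw [Finset.sum_congr rfl h1, Finset.sum_congr rfl h2, ← Finset.mul_sum, ← Finset.mul_sum,
      ih, ih, rising_succ]
    ring_nf

/-! ### Gauss's summation theorem. -/

/-- When Re c > 0 this is the lower bound for (c)ₙ. Otherwise the recurrence 1/Γ(w) = w/Γ(w+1) moves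
c to the right, and it also holds at the poles. -/
theorem norm_inv_Gamma_add_nat_le (c : ℂ) :
    ∃ C : ℝ, 0 < C ∧ ∀ n : ℕ, ‖(Complex.Gamma (c + n))⁻¹‖ ≤
      C * ((n ! : ℝ) * ((n : ℝ) + 1) ^ (c.re - 1))⁻¹ := by
  obtain ⟨k, hk⟩ := exists_nat_gt (-c.re)
  have hk : 0 < c.re + k := by linarith
  induction k generalizing c with
  | zero =>
    have hc : 0 < c.re := by simpa using hk
    obtain ⟨D, hD, h2⟩ := le_norm_rising hc
    have hG : 0 < ‖(Complex.Gamma c)⁻¹‖ := by simpa using Complex.Gamma_ne_zero_of_re_pos hc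
    refine ⟨D * ‖(Complex.Gamma c)⁻¹‖, by positivity, fun n => ?_⟩
    have h := h2 n
    have hr : 0 < ‖rising c n‖ := norm_pos_iff.2 (rising_ne_zero hc n)
    have hp : 0 < (n ! : ℝ) * ((n : ℝ) + 1) ^ (c.re - 1) := by positivity
    rw [Gamma_add_nat hc, mul_inv, norm_mul, norm_inv]
    calc ‖rising c n‖⁻¹ * ‖(Complex.Gamma c)⁻¹‖
        ≤ (D * ((n ! : ℝ) * ((n : ℝ) + 1) ^ (c.re - 1))⁻¹) * ‖(Complex.Gamma c)⁻¹‖ := by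
          gcongr
          rw [← div_eq_mul_inv, inv_eq_one_div, div_le_div_iff₀ hr hp]
          linarith
      _ = _ := by ring
  | succ k ih =>
    obtain ⟨C, hC, h1⟩ := ih (c + 1) (by push_cast at hk; simp; linarith) (by
      push_cast at hk; simp; linarith)
    refine ⟨C * (‖c‖ + 1), by positivity, fun n => ?_⟩
    have h := h1 n
    have hn : (0 : ℝ) < (n : ℝ) + 1 := by positivity
    rw [Complex.one_div_Gamma_eq_self_mul_one_div_Gamma_add_one, norm_mul,
      show c + n + 1 = c + 1 + n by ring]
    have hcn : ‖c + n‖ ≤ (‖c‖ + 1) * ((n : ℝ) + 1) := by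
      refine (norm_add_le _ _).trans ?_
      rw [Complex.norm_natCast]
      nlinarith [norm_nonneg c, (Nat.cast_nonneg n : (0 : ℝ) ≤ n)]
    calc _ ≤ ((‖c‖ + 1) * ((n : ℝ) + 1)) *
          (C * ((n ! : ℝ) * ((n : ℝ) + 1) ^ ((c + 1).re - 1))⁻¹) := by gcongr
      _ = _ := by
        have r1 : ((n : ℝ) + 1) ^ ((c + 1).re - 1) =
            ((n : ℝ) + 1) ^ (c.re - 1) * ((n : ℝ) + 1) := by
          rw [← Real.rpow_add_one hn.ne']; simp
        rw [r1]
        field_simp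

theorem summable_nat_add_one_rpow {r : ℝ} (hr : r < -1) :
    Summable (fun n : ℕ => ((n : ℝ) + 1) ^ r) := by
  have := (summable_nat_add_iff 1).2 (Real.summable_nat_rpow.2 hr)
  simpa using this

/-- The terms of the regularized Gauss series `∑ (a)ₙ (b)ₙ / (Γ(c + n) n!)`. -/
noncomputable def gaussTerm (a b c : ℂ) (n : ℕ) : ℂ :=
  rising a n * rising b n * (Complex.Gamma (c + n))⁻¹ / n !

theorem norm_gaussTerm_le (a b c : ℂ) :
    ∃ C : ℝ, 0 < C ∧ ∀ n : ℕ, ‖gaussTerm a b c n‖ ≤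
      C * ((n : ℝ) + 1) ^ (-(c - a - b).re - 1) := by
  obtain ⟨A, hA, h1⟩ := norm_rising_le a
  obtain ⟨B, hB, h2⟩ := norm_rising_le b
  obtain ⟨C, hC, h3⟩ := norm_inv_Gamma_add_nat_le c
  refine ⟨A * B * C, by positivity, fun n => ?_⟩
  have hn : (0 : ℝ) < (n : ℝ) + 1 := by positivity
  have hf : (0 : ℝ) < n ! := by exact_mod_cast n.factorial_pos
  rw [gaussTerm, norm_div, norm_mul, norm_mul, Complex.norm_natCast]
  calc _ ≤ (A * (n ! * ((n : ℝ) + 1) ^ (a.re - 1))) * (B * (n ! * ((n : ℝ) + 1) ^ (b.re - 1))) *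
        (C * ((n ! : ℝ) * ((n : ℝ) + 1) ^ (c.re - 1))⁻¹) / n ! := by
        gcongr
        · exact h1 n
        · exact h2 n
        · exact h3 n
    _ = A * B * C * (((n : ℝ) + 1) ^ (a.re - 1) * ((n : ℝ) + 1) ^ (b.re - 1) /
          ((n : ℝ) + 1) ^ (c.re - 1)) := by field_simp
    _ = _ := by
      rw [← Real.rpow_add hn, ← Real.rpow_sub hn]
      congr 2
      simp only [Complex.sub_re]; ring

theorem summable_gaussTerm {a b c : ℂ} (h : 0 < (c - a - b).re) : Summable (gaussTerm a b c) := by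
  obtain ⟨C, hC, h1⟩ := norm_gaussTerm_le a b c
  exact .of_norm_bounded ((summable_nat_add_one_rpow (by linarith)).mul_left C) h1

/-- The difference of the two sides telescopes: its N-th partial sum is -N times the N-th term,
which is O(N^(-Re(c-a-b))) and hence tends to 0. -/
theorem tsum_gaussTerm_contiguous {a b c : ℂ} (h : 0 < (c - a - b).re) :
    (c - a - b) * ∑' n, gaussTerm a b c n =
      (c - a) * (c - b) * ∑' n, gaussTerm a b (c + 1) n := by
  have h' : 0 < (c + 1 - a - b).re := by
    simp only [Complex.sub_re, Complex.add_re, Complex.one_re] at h ⊢; linarith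
  have hs := ((summable_gaussTerm h).mul_left (c - a - b)).sub
    ((summable_gaussTerm h').mul_left ((c - a) * (c - b)))
  rw [← sub_eq_zero, ← tsum_mul_left, ← tsum_mul_left,
    ← ((summable_gaussTerm h).mul_left _).tsum_sub ((summable_gaussTerm h').mul_left _)]
  refine tendsto_nhds_unique hs.hasSum.tendsto_sum_nat ?_
  have key : ∀ N : ℕ, ∑ n ∈ Finset.range N, ((c - a - b) * gaussTerm a b c n -
      (c - a) * (c - b) * gaussTerm a b (c + 1) n) = -((N : ℂ) * gaussTerm a b c N) := by
    intro N
    induction N with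
    | zero => simp
    | succ N ih =>
      rw [Finset.sum_range_succ, ih]
      have hG := Complex.one_div_Gamma_eq_self_mul_one_div_Gamma_add_one (c + N)
      simp only [gaussTerm]
      rw [hG, rising_succ, rising_succ, Nat.factorial_succ,
        show c + ((N + 1 : ℕ) : ℂ) = c + N + 1 by push_cast; ring,
        show c + 1 + (N : ℂ) = c + N + 1 by ring]
      have hf : (N ! : ℂ) ≠ 0 := by exact_mod_cast N.factorial_ne_zero
      have hN : (N : ℂ) + 1 ≠ 0 := by exact_mod_cast N.succ_ne_zero
      push_cast
      field_simp
      ring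
  simp_rw [key]
  rw [← neg_zero]
  refine Tendsto.neg ?_
  obtain ⟨C, hC, h1⟩ := norm_gaussTerm_le a b c
  refine squeeze_zero_norm (a := fun n : ℕ => C * ((n : ℝ) + 1) ^ (-(c - a - b).re)) ?_ ?_
  · intro n
    have hn : (0 : ℝ) < (n : ℝ) + 1 := by positivity
    rw [norm_mul, Complex.norm_natCast]
    calc (n : ℝ) * ‖gaussTerm a b c n‖
        ≤ ((n : ℝ) + 1) * (C * ((n : ℝ) + 1) ^ (-(c - a - b).re - 1)) := by
          gcongr
          · linarith
          · exact h1 n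
      _ = _ := by rw [Real.rpow_sub_one hn.ne']; field_simp
  · have := (tendsto_rpow_neg_atTop h).comp
      (tendsto_atTop_add_const_right atTop (1 : ℝ) tendsto_natCast_atTop_atTop)
    simpa using this.const_mul C

theorem norm_add_nat_ge {z : ℂ} (hz : 0 < z.re) (n j : ℕ) : ‖z + j‖ ≤ ‖z + n + j‖ := by
  rw [Complex.norm_eq_sqrt_sq_add_sq, Complex.norm_eq_sqrt_sq_add_sq]
  have hn : (0 : ℝ) ≤ n := n.cast_nonneg
  have hj : (0 : ℝ) ≤ j := j.cast_nonneg
  simp only [Complex.add_re, Complex.natCast_re, Complex.add_im, Complex.natCast_im, add_zero]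
  gcongr
  linarith

theorem norm_rising_add_nat_ge {z : ℂ} (hz : 0 < z.re) (n k : ℕ) :
    ‖rising z k‖ ≤ ‖rising (z + n) k‖ := by
  rw [rising_eq_prod, rising_eq_prod, norm_prod, norm_prod]
  exact Finset.prod_le_prod (fun _ _ => norm_nonneg _) (fun j _ => norm_add_nat_ge hz n j)

theorem re_add_nat_pos {z : ℂ} (hz : 0 < z.re) (n : ℕ) : 0 < (z + n).re := by
  have : (0 : ℝ) ≤ n := n.cast_nonneg
  simp; linarith

theorem gaussTerm_eq {a b c : ℂ} (hc : 0 < c.re) (k : ℕ) :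
    gaussTerm a b c k =
      (Complex.Gamma c)⁻¹ * (rising a k * rising b k / (rising c k * k !)) := by
  have hG : Complex.Gamma c ≠ 0 := Complex.Gamma_ne_zero_of_re_pos hc
  have hr := rising_ne_zero hc k
  rw [gaussTerm, Gamma_add_nat hc]
  field_simp

/-- The expression is the ordinary series ₂F₁(a, b; c+n; 1), in which every term but the zeroth
vanishes as n → ∞. Because |(c+n)ₖ| ≥ |(c)ₖ|, the series at n = 0 is a dominating one. -/
theorem tendsto_Gamma_mul_tsum_gaussTerm {a b c : ℂ} (hc : 0 < c.re) (h : 0 < (c - a - b).re) :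
    Tendsto (fun n : ℕ => Complex.Gamma (c + n) * ∑' k, gaussTerm a b (c + n) k) atTop (𝓝 1) := by
  have hlim : Tendsto (fun n : ℕ => ∑' k, rising a k * rising b k / (rising (c + n) k * k !))
      atTop (𝓝 (∑' k, if k = 0 then (1 : ℂ) else 0)) := by
    refine tendsto_tsum_of_dominated_convergence
      (bound := fun k => ‖rising a k * rising b k / (rising c k * k !)‖) ?_ ?_ ?_
    · have hs := (summable_gaussTerm h).norm.mul_left ‖Complex.Gamma c‖
      refine hs.congr fun k => ?_
      have hG : Complex.Gamma c ≠ 0 := Complex.Gamma_ne_zero_of_re_pos hc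
      rw [← norm_mul, gaussTerm_eq hc, mul_inv_cancel_left₀ hG]
    · rintro (_ | k)
      · simp
      · simp only [Nat.add_eq_zero_iff, one_ne_zero, and_false, if_false]
        have hb : Tendsto (fun n : ℕ =>
            (‖rising a (k + 1) * rising b (k + 1)‖ / (‖rising (c + 1) k‖ * (k + 1)!)) *
              ((n : ℝ))⁻¹) atTop (𝓝 0) := by
          have := (tendsto_inv_atTop_zero.comp
            (tendsto_natCast_atTop_atTop (R := ℝ))).const_mul
            (‖rising a (k + 1) * rising b (k + 1)‖ / (‖rising (c + 1) k‖ * (k + 1)!))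
          simpa using this
        refine squeeze_zero_norm' ?_ hb
        filter_upwards [eventually_gt_atTop 0] with n hn
        have hn0 : (0 : ℝ) < n := by exact_mod_cast hn
        have hc1 : 0 < (c + 1).re := by simp; linarith
        have h1 := norm_rising_add_nat_ge hc1 n k
        have h0 : 0 < ‖rising (c + 1) k‖ := norm_pos_iff.2 (rising_ne_zero hc1 k)
        have hcn : (n : ℝ) ≤ ‖c + n‖ := by
          refine le_trans ?_ (Complex.re_le_norm _)
          simp; linarith
        rw [rising_succ_left (c + n), norm_div, norm_mul (_ * _) (((k + 1)! : ℕ) : ℂ),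
          norm_mul (c + n), Complex.norm_natCast, ← div_eq_mul_inv, div_div,
          show c + n + 1 = c + 1 + n by ring]
        have hf : (0 : ℝ) < ((k + 1)! : ℕ) := by exact_mod_cast (k + 1).factorial_pos
        refine div_le_div_of_nonneg_left (norm_nonneg _) (by positivity) ?_
        calc ‖rising (c + 1) k‖ * ((k + 1)! : ℕ) * (n : ℝ)
            = (n : ℝ) * ‖rising (c + 1) k‖ * ((k + 1)! : ℕ) := by ring
          _ ≤ _ := by gcongr
    · refine Eventually.of_forall fun n k => ?_
      have h0 : 0 < ‖rising c k‖ := norm_pos_iff.2 (rising_ne_zero hc k)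
      rw [norm_div, norm_div, norm_mul (rising (c + n) k), norm_mul (rising c k)]
      have hf : (0 : ℝ) < ‖(k ! : ℂ)‖ := by
        rw [Complex.norm_natCast]; exact_mod_cast k.factorial_pos
      gcongr
      exact norm_rising_add_nat_ge hc n k
  rw [tsum_ite_eq] at hlim
  refine hlim.congr fun n => ?_
  have hcn := re_add_nat_pos hc n
  have hG : Complex.Gamma (c + n) ≠ 0 := Complex.Gamma_ne_zero_of_re_pos hcn
  rw [← tsum_mul_left]
  refine tsum_congr fun k => ?_
  rw [gaussTerm_eq hcn, mul_inv_cancel_left₀ hG]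

/-- `Γ(z + n) ~ n! n^(z - 1)`. -/
theorem tendsto_Gamma_add_nat_div {z : ℂ} (hz : 0 < z.re) :
    Tendsto (fun n : ℕ => Complex.Gamma (z + n) / (n ! * (n : ℂ) ^ (z - 1))) atTop (𝓝 1) := by
  have hG : Complex.Gamma z ≠ 0 := Complex.Gamma_ne_zero_of_re_pos hz
  have h1 := ((Complex.GammaSeq_tendsto_Gamma z).inv₀ hG).const_mul (Complex.Gamma z)
  rw [mul_inv_cancel₀ hG] at h1
  have h2 : Tendsto (fun n : ℕ => (n : ℂ) / ((n : ℂ) + z)) atTop (𝓝 1) :=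
    tendsto_natCast_div_add_atTop (𝕜 := ℂ) z
  have h3 := h1.mul h2
  rw [one_mul] at h3
  refine h3.congr' ?_
  filter_upwards [eventually_gt_atTop 0] with n hn
  have hn0 : (n : ℂ) ≠ 0 := by exact_mod_cast hn.ne'
  have hseq : Complex.GammaSeq z n = (n : ℂ) ^ z * n ! / (rising z n * (z + n)) := by
    rw [← rising_succ, rising_eq_prod]; rfl
  have hzn := add_natCast_ne_zero hz n
  have hzn' : (n : ℂ) + z ≠ 0 := by rwa [add_comm]
  have hf : (n ! : ℂ) ≠ 0 := by exact_mod_cast n.factorial_ne_zero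
  have hp : (n : ℂ) ^ z ≠ 0 := by simp [Complex.cpow_eq_zero_iff, hn0]
  rw [hseq, Gamma_add_nat hz, Complex.cpow_sub _ _ hn0, Complex.cpow_one]
  field_simp
  ring

theorem tsum_gaussTerm_of_re_pos {a b c : ℂ} (hc : 0 < c.re) (hca : 0 < (c - a).re)
    (hcb : 0 < (c - b).re) (h : 0 < (c - a - b).re) :
    ∑' n, gaussTerm a b c n =
      Complex.Gamma (c - a - b) * (Complex.Gamma (c - a))⁻¹ * (Complex.Gamma (c - b))⁻¹ := by
  have hG0 := Complex.Gamma_ne_zero_of_re_pos h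
  have hG1 := Complex.Gamma_ne_zero_of_re_pos hca
  have hG2 := Complex.Gamma_ne_zero_of_re_pos hcb
  -- By contiguity this normalized sum does not change under c → c + 1, so it equals its limit as n
  -- → ∞.
  have hconst : ∀ n : ℕ, Complex.Gamma (c - a + n) * Complex.Gamma (c - b + n) /
      Complex.Gamma (c - a - b + n) * ∑' k, gaussTerm a b (c + n) k =
      Complex.Gamma (c - a) * Complex.Gamma (c - b) /
        Complex.Gamma (c - a - b) * ∑' k, gaussTerm a b c k := by
    intro n
    induction n with
    | zero => simp
    | succ n ih =>
      rw [← ih]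
      have e := tsum_gaussTerm_contiguous (a := a) (b := b) (c := c + n) (by
        have := re_add_nat_pos h n
        rwa [show c + n - a - b = c - a - b + n by ring])
      have r0 := add_natCast_ne_zero h n
      have r1 := add_natCast_ne_zero hca n
      have r2 := add_natCast_ne_zero hcb n
      have g0 := Complex.Gamma_ne_zero_of_re_pos (re_add_nat_pos h n)
      push_cast
      simp only [← add_assoc]
      rw [Complex.Gamma_add_one _ r0, Complex.Gamma_add_one _ r1, Complex.Gamma_add_one _ r2]
      rw [show c + n - a - b = c - a - b + n by ring, show c + n - a = c - a + n by ring,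
        show c + n - b = c - b + n by ring] at e
      field_simp
      linear_combination -(Complex.Gamma (c - a + n) * Complex.Gamma (c - b + n)) * e
  have hlim := (tendsto_Gamma_mul_tsum_gaussTerm (a := a) (b := b) hc h).mul
    (((tendsto_Gamma_add_nat_div hca).mul (tendsto_Gamma_add_nat_div hcb)).div
    ((tendsto_Gamma_add_nat_div h).mul (tendsto_Gamma_add_nat_div hc)) (by norm_num))
  have hlim2 : Tendsto (fun _ : ℕ => Complex.Gamma (c - a) * Complex.Gamma (c - b) /
        Complex.Gamma (c - a - b) * ∑' k, gaussTerm a b c k) atTop (𝓝 1) := by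
    norm_num at hlim
    refine hlim.congr' ?_
    filter_upwards [eventually_gt_atTop 0] with n hn
    have hn0 : (n : ℂ) ≠ 0 := by exact_mod_cast hn.ne'
    rw [← hconst n]
    have g0 := Complex.Gamma_ne_zero_of_re_pos (re_add_nat_pos h n)
    have g1 := Complex.Gamma_ne_zero_of_re_pos (re_add_nat_pos hc n)
    have hf : (n ! : ℂ) ≠ 0 := by exact_mod_cast n.factorial_ne_zero
    have hp : ∀ z : ℂ, (n : ℂ) ^ z ≠ 0 := fun z => by simp [Complex.cpow_eq_zero_iff, hn0]
    -- The powers of n in the four Gamma asymptotics cancel because (c-a) + (c-b) = (c-a-b) + c.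
    have hpow : (n : ℂ) ^ (c - a - 1) * (n : ℂ) ^ (c - b - 1) =
        (n : ℂ) ^ (c - a - b - 1) * (n : ℂ) ^ (c - 1) := by
      rw [← Complex.cpow_add _ _ hn0, ← Complex.cpow_add _ _ hn0]; ring_nf
    have := hp (c - a - 1)
    have := hp (c - b - 1)
    have := hp (c - a - b - 1)
    have := hp (c - 1)
    field_simp
    linear_combination -(∑' k, gaussTerm a b (c + n) k) * Complex.Gamma (c - a + n) *
      Complex.Gamma (c - b + n) * hpow
  have := tendsto_nhds_unique tendsto_const_nhds hlim2
  field_simp at this ⊢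
  linear_combination this

/-- Gauss's summation theorem, in regularized form. -/
theorem tsum_gaussTerm {a b c : ℂ} (h : 0 < (c - a - b).re) :
    ∑' n, gaussTerm a b c n =
      Complex.Gamma (c - a - b) * (Complex.Gamma (c - a))⁻¹ * (Complex.Gamma (c - b))⁻¹ := by
  obtain ⟨k, hk⟩ := exists_nat_gt (|c.re| + |a.re| + |b.re|)
  have hk : |c.re| + |a.re| + |b.re| - k < 0 := by linarith
  -- Contiguity is solved for the sum at c, where only c - a - b ≠ 0 is needed. The factors
  -- (c-a)(c-b), possibly zero, are absorbed by the recurrence of 1/Γ. This removes the positivity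
  -- of Re c, Re(c-a) and Re(c-b).
  have aux : ∀ k : ℕ, ∀ c : ℂ, 0 < (c - a - b).re → 0 < c.re + k → 0 < (c - a).re + k →
      0 < (c - b).re + k → ∑' n, gaussTerm a b c n =
      Complex.Gamma (c - a - b) * (Complex.Gamma (c - a))⁻¹ * (Complex.Gamma (c - b))⁻¹ := by
    intro k
    induction k with
    | zero =>
      intro c h h1 h2 h3
      simp only [Nat.cast_zero, add_zero] at h1 h2 h3
      exact tsum_gaussTerm_of_re_pos h1 h2 h3 h
    | succ k ih =>
      intro c h h1 h2 h3
      have e := ih (c + 1) (by simp at h ⊢; linarith) (by push_cast at h1; simp; linarith)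
        (by push_cast at h2; simp at h2 ⊢; linarith) (by push_cast at h3; simp at h3 ⊢; linarith)
      have e2 := tsum_gaussTerm_contiguous (a := a) (b := b) h
      have h0 : c - a - b ≠ 0 := by
        intro h0; rw [h0] at h; simp at h
      rw [e, show c + 1 - a - b = c - a - b + 1 by ring, Complex.Gamma_add_one _ h0] at e2
      rw [Complex.one_div_Gamma_eq_self_mul_one_div_Gamma_add_one (c - a),
        Complex.one_div_Gamma_eq_self_mul_one_div_Gamma_add_one (c - b)]
      refine mul_left_cancel₀ h0 ?_
      rw [e2, show c + 1 - a = c - a + 1 by ring, show c + 1 - b = c - b + 1 by ring]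
      ring
  have ac := neg_abs_le c.re
  have aa := le_abs_self a.re
  have ab := le_abs_self b.re
  have pa := abs_nonneg a.re
  have pb := abs_nonneg b.re
  exact aux k c h (by linarith) (by simp; linarith) (by simp; linarith)

/-! ### Convergence of the Pfaff-transformed double series. -/

theorem summable_add_one_pow_mul_geometric {r : ℝ} (h0 : 0 ≤ r) (h1 : r < 1) (M : ℕ) :
    Summable (fun n : ℕ => ((n : ℝ) + 1) ^ M * r ^ n) := by
  rcases h0.eq_or_lt with rfl | h0
  · refine summable_of_ne_finset_zero (s := {0}) fun n hn => ?_
    have : n ≠ 0 := by simpa using hn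
    simp [this]
  have h := (summable_nat_add_iff 1).2
    (summable_pow_mul_geometric_of_norm_lt_one M (r := r) (by rwa [Real.norm_of_nonneg h0.le]))
  refine (h.mul_right r⁻¹).congr fun n => ?_
  push_cast
  rw [pow_succ]
  field_simp

/-- A double power series with coefficients of polynomial growth converges in the unit polydisc. -/
theorem summable_double_of_poly_bound {d : ℕ × ℕ → ℂ} {C : ℝ} {M : ℕ}
    (hd : ∀ q, ‖d q‖ ≤ C * (((q.1 : ℝ) + 1) ^ M * ((q.2 : ℝ) + 1) ^ M)) {u v : ℂ}
    (hu : ‖u‖ < 1) (hv : ‖v‖ < 1) : Summable (fun q : ℕ × ℕ => d q * u ^ q.1 * v ^ q.2) := by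
  have h := ((summable_add_one_pow_mul_geometric (norm_nonneg u) hu M).mul_of_nonneg
    (summable_add_one_pow_mul_geometric (norm_nonneg v) hv M)
    (fun n => by positivity) (fun n => by positivity)).mul_left C
  refine .of_norm_bounded h fun q => ?_
  rw [norm_mul, norm_mul, norm_pow, norm_pow]
  calc ‖d q‖ * ‖u‖ ^ q.1 * ‖v‖ ^ q.2
      ≤ (C * (((q.1 : ℝ) + 1) ^ M * ((q.2 : ℝ) + 1) ^ M)) * ‖u‖ ^ q.1 * ‖v‖ ^ q.2 := by
        gcongr; exact hd q
    _ = _ := by ring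

/-- The coefficients of the double series that Pfaff's transformation of the second variable of
`F₃` produces. -/
noncomputable def pfaffCoeff (lam lam' ξ ξ' γ : ℂ) (q : ℕ × ℕ) : ℂ :=
  rising lam q.1 * rising ξ q.1 * (rising lam' q.2 * rising (γ - ξ' + q.1) q.2) /
    (rising γ (q.1 + q.2) * (q.1 ! * q.2 !))

/-- The factorials cancel, and (γ-ξ'+m)ₙ/(γ)ₘ₊ₙ leaves the joint power (m+n+1)^(-Re ξ'). That power
is kept unsplit, since the sharp convergence conditions depend on how it is later shared between m
and n. -/
theorem norm_pfaffCoeff_le (lam lam' ξ ξ' : ℂ) {γ : ℂ} (hγ : 0 < γ.re) :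
    ∃ C : ℝ, 0 < C ∧ ∀ q : ℕ × ℕ, ‖pfaffCoeff lam lam' ξ ξ' γ q‖ ≤
      C * (((q.1 : ℝ) + 1) ^ ((lam + ξ - γ + ξ').re - 1) * ((q.2 : ℝ) + 1) ^ (lam'.re - 1) *
        ((q.1 : ℝ) + q.2 + 1) ^ (-ξ'.re)) := by
  obtain ⟨A, hA, h1⟩ := norm_rising_le lam
  obtain ⟨B, hB, h2⟩ := norm_rising_le ξ
  obtain ⟨D, hD, h3⟩ := norm_rising_le lam'
  obtain ⟨E, hE, h4⟩ := norm_rising_add_nat_le (γ - ξ')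
  obtain ⟨F, hF, h5⟩ := le_norm_rising hγ
  refine ⟨A * B * (D * E) * F, by positivity, fun q => ?_⟩
  obtain ⟨m, n⟩ := q
  have hm : (0 : ℝ) < (m : ℝ) + 1 := by positivity
  have hn : (0 : ℝ) < (n : ℝ) + 1 := by positivity
  have hN : (0 : ℝ) < (m : ℝ) + n + 1 := by positivity
  have fm : (0 : ℝ) < m ! := by exact_mod_cast m.factorial_pos
  have fn : (0 : ℝ) < n ! := by exact_mod_cast n.factorial_pos
  have fN : (0 : ℝ) < (m + n)! := by exact_mod_cast (m + n).factorial_pos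
  have hr : 0 < ‖rising γ (m + n)‖ := norm_pos_iff.2 (rising_ne_zero hγ _)
  have h5' := h5 (m + n)
  push_cast at h5'
  have hinv : (‖rising γ (m + n)‖)⁻¹ ≤
      F * ((m + n)! * ((m : ℝ) + n + 1) ^ (γ.re - 1))⁻¹ := by
    rw [← div_eq_mul_inv, inv_eq_one_div, div_le_div_iff₀ hr (by positivity)]
    linarith
  simp only [pfaffCoeff]
  rw [norm_div, norm_mul, norm_mul, norm_mul, norm_mul, norm_mul, Complex.norm_natCast,
    Complex.norm_natCast, div_eq_mul_inv, mul_inv]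
  simp only [div_eq_mul_inv] at h4
  calc _ ≤ (A * (m ! * ((m : ℝ) + 1) ^ (lam.re - 1))) * (B * (m ! * ((m : ℝ) + 1) ^ (ξ.re - 1))) *
        ((D * (n ! * ((n : ℝ) + 1) ^ (lam'.re - 1))) *
          (E * (((m + n)! : ℝ) * (m ! : ℝ)⁻¹ * (((m : ℝ) + n + 1) ^ ((γ - ξ').re - 1) *
            (((m : ℝ) + 1) ^ ((γ - ξ').re - 1))⁻¹)))) *
        ((F * ((m + n)! * ((m : ℝ) + n + 1) ^ (γ.re - 1))⁻¹) * ((m ! : ℝ) * n !)⁻¹) := by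
        gcongr
        · exact h1 m
        · exact h2 m
        · exact h3 n
        · exact h4 m n
    _ = A * B * (D * E) * F * ((((m : ℝ) + 1) ^ (lam.re - 1) * ((m : ℝ) + 1) ^ (ξ.re - 1) /
          ((m : ℝ) + 1) ^ ((γ - ξ').re - 1)) * ((n : ℝ) + 1) ^ (lam'.re - 1) *
          (((m : ℝ) + n + 1) ^ ((γ - ξ').re - 1) / ((m : ℝ) + n + 1) ^ (γ.re - 1))) := by
        field_simp
    _ = _ := by
        rw [← Real.rpow_add hm, ← Real.rpow_sub hm, ← Real.rpow_sub hN,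
          show lam.re - 1 + (ξ.re - 1) - ((γ - ξ').re - 1) = (lam + ξ - γ + ξ').re - 1 by
            simp only [Complex.sub_re, Complex.add_re]; ring,
          show (γ - ξ').re - 1 - (γ.re - 1) = -ξ'.re by simp only [Complex.sub_re]; ring]

theorem rpow_le_pow_of_abs_le {x : ℝ} (hx : 1 ≤ x) {r : ℝ} {M : ℕ} (h : |r| ≤ M) :
    x ^ r ≤ x ^ M := by
  rw [← Real.rpow_natCast]
  exact Real.rpow_le_rpow_of_exponent_le hx ((le_abs_self r).trans h)

theorem pfaffCoeff_poly_bound (lam lam' ξ ξ' : ℂ) {γ : ℂ} (hγ : 0 < γ.re) :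
    ∃ (C : ℝ) (M : ℕ), ∀ q : ℕ × ℕ, ‖pfaffCoeff lam lam' ξ ξ' γ q‖ ≤
      C * (((q.1 : ℝ) + 1) ^ M * ((q.2 : ℝ) + 1) ^ M) := by
  obtain ⟨C, hC, h⟩ := norm_pfaffCoeff_le lam lam' ξ ξ' hγ
  obtain ⟨M, hM⟩ := exists_nat_ge (max (max |(lam + ξ - γ + ξ').re - 1| |lam'.re - 1|) |-ξ'.re|)
  simp only [max_le_iff] at hM
  refine ⟨C, 2 * M, fun q => (h q).trans ?_⟩
  have hm : (1 : ℝ) ≤ (q.1 : ℝ) + 1 := by linarith [(Nat.cast_nonneg q.1 : (0 : ℝ) ≤ q.1)]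
  have hn : (1 : ℝ) ≤ (q.2 : ℝ) + 1 := by linarith [(Nat.cast_nonneg q.2 : (0 : ℝ) ≤ q.2)]
  have hN : (1 : ℝ) ≤ (q.1 : ℝ) + q.2 + 1 := by linarith
  have hN' : (q.1 : ℝ) + q.2 + 1 ≤ ((q.1 : ℝ) + 1) * ((q.2 : ℝ) + 1) := by nlinarith
  gcongr C * ?_
  calc _ ≤ ((q.1 : ℝ) + 1) ^ M * ((q.2 : ℝ) + 1) ^ M * ((q.1 : ℝ) + q.2 + 1) ^ M := by
        gcongr
        · exact rpow_le_pow_of_abs_le hm hM.1.1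
        · exact rpow_le_pow_of_abs_le hn hM.1.2
        · exact rpow_le_pow_of_abs_le hN hM.2
    _ ≤ ((q.1 : ℝ) + 1) ^ M * ((q.2 : ℝ) + 1) ^ M *
          (((q.1 : ℝ) + 1) * ((q.2 : ℝ) + 1)) ^ M := by gcongr
    _ = _ := by rw [mul_pow]; ring

theorem summable_pfaffCoeff (lam lam' ξ ξ' : ℂ) {γ : ℂ} (hγ : 0 < γ.re) {u v : ℂ}
    (hu : ‖u‖ < 1) (hv : ‖v‖ < 1) :
    Summable (fun q : ℕ × ℕ => pfaffCoeff lam lam' ξ ξ' γ q * u ^ q.1 * v ^ q.2) := by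
  obtain ⟨C, M, h⟩ := pfaffCoeff_poly_bound lam lam' ξ ξ' hγ
  exact summable_double_of_poly_bound h hu hv

/-- The diagonal value `∑ dₘₙ uᵐ⁺ⁿ` of the transformed double series. -/
noncomputable def pfaffDiag (lam lam' ξ ξ' γ u : ℂ) : ℂ :=
  ∑' q : ℕ × ℕ, pfaffCoeff lam lam' ξ ξ' γ q * u ^ (q.1 + q.2)

theorem summable_pfaffDiag (lam lam' ξ ξ' : ℂ) {γ : ℂ} (hγ : 0 < γ.re) {u : ℂ}
    (hu : ‖u‖ < 1) :
    Summable (fun q : ℕ × ℕ => pfaffCoeff lam lam' ξ ξ' γ q * u ^ (q.1 + q.2)) := by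
  simpa only [pow_add, mul_assoc] using summable_pfaffCoeff lam lam' ξ ξ' hγ hu hu

/-- The weight is the size of the beta value B(γ+m+n, s), so this is the absolute convergence behind
termwise integration. -/
theorem summable_pfaffCoeff_mul_rpow {lam lam' ξ ξ' γ s : ℂ} (hγ : 0 < γ.re)
    (hlam' : 0 < lam'.re) (h1 : 0 < (s + γ - lam - lam' - ξ).re) (h2 : 0 < (s + ξ' - lam').re) :
    Summable (fun q : ℕ × ℕ =>
      ‖pfaffCoeff lam lam' ξ ξ' γ q‖ * ((q.1 : ℝ) + q.2 + 1) ^ (-s.re)) := by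
  obtain ⟨C, hC, h⟩ := norm_pfaffCoeff_le lam lam' ξ ξ' hγ
  set A := (lam + ξ - γ + ξ').re with hA
  set S := (s + ξ').re with hS
  have e1 : 0 < S - lam'.re := by simpa [hS] using h2
  have e2 : 0 < S - lam'.re - A := by
    simp only [hS, hA, Complex.sub_re, Complex.add_re] at h1 ⊢; linarith
  -- The exponent S of m + n + 1 is divided as (Re λ' + ε) for n and (S - Re λ' - ε) for m. Both
  -- parts are positive, the first because Re λ' > 0, and each resulting single series has exponent
  -- below -1.
  obtain ⟨ε, hε, hε1, hε2⟩ : ∃ ε : ℝ, 0 < ε ∧ ε < S - lam'.re ∧ ε < S - lam'.re - A := by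
    obtain ⟨ε, h, h'⟩ := exists_between (lt_min e1 e2)
    exact ⟨ε, h, h'.trans_le (min_le_left _ _), h'.trans_le (min_le_right _ _)⟩
  have hs := ((summable_nat_add_one_rpow (r := A - 1 - (S - lam'.re - ε)) (by linarith)).mul_of_nonneg
    (summable_nat_add_one_rpow (r := -1 - ε) (by linarith))
    (fun n => by positivity) (fun n => by positivity)).mul_left C
  refine .of_nonneg_of_le (fun q => by positivity) (fun q => ?_) hs
  have hm : (0 : ℝ) < (q.1 : ℝ) + 1 := by positivity
  have hn : (0 : ℝ) < (q.2 : ℝ) + 1 := by positivity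
  have hN : (0 : ℝ) < (q.1 : ℝ) + q.2 + 1 := by positivity
  calc _ ≤ (C * (((q.1 : ℝ) + 1) ^ (A - 1) * ((q.2 : ℝ) + 1) ^ (lam'.re - 1) *
        ((q.1 : ℝ) + q.2 + 1) ^ (-ξ'.re))) * ((q.1 : ℝ) + q.2 + 1) ^ (-s.re) := by
        gcongr; exact h q
    _ = C * ((((q.1 : ℝ) + 1) ^ (A - 1) * ((q.2 : ℝ) + 1) ^ (lam'.re - 1)) *
        (((q.1 : ℝ) + q.2 + 1) ^ (-(S - lam'.re - ε)) *
          ((q.1 : ℝ) + q.2 + 1) ^ (-(lam'.re + ε)))) := by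
        rw [← Real.rpow_add hN, mul_assoc, mul_assoc _ (_ ^ (-ξ'.re)), ← Real.rpow_add hN]
        congr 3
        simp only [hS, Complex.add_re]; ring
    _ ≤ C * ((((q.1 : ℝ) + 1) ^ (A - 1) * ((q.2 : ℝ) + 1) ^ (lam'.re - 1)) *
        (((q.1 : ℝ) + 1) ^ (-(S - lam'.re - ε)) * ((q.2 : ℝ) + 1) ^ (-(lam'.re + ε)))) := by
        gcongr C * (_ * (?_ * ?_))
        · exact Real.rpow_le_rpow_of_nonpos hm
            (by linarith [(Nat.cast_nonneg q.2 : (0 : ℝ) ≤ q.2)]) (by linarith)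
        · exact Real.rpow_le_rpow_of_nonpos hn
            (by linarith [(Nat.cast_nonneg q.1 : (0 : ℝ) ≤ q.1)]) (by linarith)
    _ = _ := by
        rw [show A - 1 - (S - lam'.re - ε) = (A - 1) + -(S - lam'.re - ε) by ring,
          show -1 - ε = (lam'.re - 1) + -(lam'.re + ε) by ring, Real.rpow_add hm, Real.rpow_add hn]
        ring

/-! ### The beta-type transform of the diagonal series. -/

/-- Tonelli on the sum of norms. It supplies integrability of the sum itself, which accompanies the
termwise evaluation of the integral. -/
theorem integrable_tsum_of_summable_integral_norm {α ι : Type*} [MeasurableSpace α]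
    {ν : Measure α} [Countable ι] {F : ι → α → ℂ} (hF : ∀ i, Integrable (F i) ν)
    (hF_sum : Summable fun i => ∫ a, ‖F i a‖ ∂ν) (hs : ∀ᵐ a ∂ν, Summable fun i => F i a) :
    Integrable (fun a => ∑' i, F i a) ν := by
  refine ⟨aestronglyMeasurable_of_tendsto_ae atTop (f := fun (s : Finset ι) a => ∑ i ∈ s, F i a)
    (fun s => ?_) ?_, ?_⟩
  · exact Finset.aestronglyMeasurable_fun_sum s fun i _ => (hF i).1
  · filter_upwards [hs] with a ha using ha.hasSum
  · refine lt_of_le_of_lt (lintegral_mono fun a => enorm_tsum_le_tsum_enorm) ?_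
    rw [lintegral_tsum fun i => (hF i).1.enorm]
    have (i : ι) : ∫⁻ a, ‖F i a‖ₑ ∂ν = ENNReal.ofReal (∫ a, ‖F i a‖ ∂ν) := by
      rw [ofReal_integral_eq_lintegral_ofReal (hF i).norm (ae_of_all _ fun a => norm_nonneg _)]
      simp
    simp_rw [this]
    exact hF_sum.tsum_ofReal_lt_top

/-- The integrand of the beta-type transform of `pfaffDiag`. -/
noncomputable def pfaffIntegrand (lam lam' ξ ξ' γ s : ℂ) (u : ℝ) : ℂ :=
  (u : ℂ) ^ (γ - 1) * (1 - (u : ℂ)) ^ (s - 1) * pfaffDiag lam lam' ξ ξ' γ u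

/-- The Gamma quotient in the image of a power under the Marichev–Saigo–Maeda integral. -/
noncomputable def gammaQuotient (lam lam' ξ ξ' γ s : ℂ) : ℂ :=
  Complex.Gamma s * Complex.Gamma (s + γ - lam - lam' - ξ) * Complex.Gamma (s + ξ' - lam') *
    ((Complex.Gamma (s + ξ'))⁻¹ * (Complex.Gamma (s + γ - lam - lam'))⁻¹ *
      (Complex.Gamma (s + γ - lam' - ξ))⁻¹)

theorem norm_beta_integrand {z w : ℂ} {u : ℝ} (hu : u ∈ Set.Ioo (0 : ℝ) 1) :
    ‖(u : ℂ) ^ (z - 1) * (1 - (u : ℂ)) ^ (w - 1)‖ = u ^ (z.re - 1) * (1 - u) ^ (w.re - 1) := by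
  have h1 : (1 - (u : ℂ)) = ((1 - u : ℝ) : ℂ) := by push_cast; rfl
  rw [norm_mul, h1, Complex.norm_cpow_eq_rpow_re_of_pos hu.1,
    Complex.norm_cpow_eq_rpow_re_of_pos (by linarith [hu.2])]
  simp

theorem integral_norm_beta_integrand (z w : ℂ) :
    ((∫ u in Set.Ioo (0 : ℝ) 1, ‖(u : ℂ) ^ (z - 1) * (1 - (u : ℂ)) ^ (w - 1)‖ : ℝ) : ℂ) =
      Complex.betaIntegral z.re w.re := by
  rw [Complex.betaIntegral, intervalIntegral.integral_of_le zero_le_one,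
    integral_Ioc_eq_integral_Ioo, ← integral_complex_ofReal]
  refine setIntegral_congr_fun measurableSet_Ioo fun u hu => ?_
  have h1 : (1 - (u : ℂ)) = ((1 - u : ℝ) : ℂ) := by push_cast; rfl
  rw [norm_beta_integrand hu, h1, Complex.ofReal_mul, Complex.ofReal_cpow hu.1.le,
    Complex.ofReal_cpow (by linarith [hu.2])]
  push_cast
  rfl

theorem betaIntegral_add_nat {z w : ℂ} (hz : 0 < z.re) (hw : 0 < w.re) (N : ℕ) :
    Complex.betaIntegral (z + N) w =
      Complex.Gamma z * Complex.Gamma w * (rising z N * (Complex.Gamma (z + w + N))⁻¹) := by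
  have h := Complex.Gamma_mul_Gamma_eq_betaIntegral (re_add_nat_pos hz N) hw
  have hG : Complex.Gamma (z + N + w) ≠ 0 :=
    Complex.Gamma_ne_zero_of_re_pos (by
      have := re_add_nat_pos hz N
      rw [Complex.add_re]; linarith)
  rw [Gamma_add_nat hz] at h
  rw [show z + w + N = z + N + w by ring]
  field_simp
  linear_combination -h

theorem norm_betaIntegral_add_nat_le {z w : ℂ} (hz : 0 < z.re) (hw : 0 < w.re) :
    ∃ C : ℝ, 0 < C ∧ ∀ N : ℕ, ‖Complex.betaIntegral (z + N) w‖ ≤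
      C * ((N : ℝ) + 1) ^ (-w.re) := by
  obtain ⟨A, hA, h1⟩ := norm_rising_le z
  obtain ⟨B, hB, h2⟩ := norm_inv_Gamma_add_nat_le (z + w)
  refine ⟨‖Complex.Gamma z * Complex.Gamma w‖ * (A * B) + 1, by positivity, fun N => ?_⟩
  have hN : (0 : ℝ) < (N : ℝ) + 1 := by positivity
  have hf : (0 : ℝ) < N ! := by exact_mod_cast N.factorial_pos
  rw [betaIntegral_add_nat hz hw, norm_mul, norm_mul (rising z N)]
  have hp : 0 < ((N : ℝ) + 1) ^ (-w.re) := by positivity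
  calc _ ≤ ‖Complex.Gamma z * Complex.Gamma w‖ * ((A * (N ! * ((N : ℝ) + 1) ^ (z.re - 1))) *
        (B * ((N ! : ℝ) * ((N : ℝ) + 1) ^ ((z + w).re - 1))⁻¹)) := by
        gcongr
        · exact h1 N
        · exact h2 N
    _ = ‖Complex.Gamma z * Complex.Gamma w‖ * (A * B) * ((N : ℝ) + 1) ^ (-w.re) := by
        have e : ((N : ℝ) + 1) ^ (-w.re) =
            ((N : ℝ) + 1) ^ (z.re - 1) / ((N : ℝ) + 1) ^ ((z + w).re - 1) := by
          rw [← Real.rpow_sub hN]; simp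
        rw [e]
        field_simp
    _ ≤ _ := by linarith

/-- In the inner Gauss sum over n the excess c - a - b equals s + ξ' - λ', independent of m. What
remains in m is again a Gauss series, with lower parameter γ + s - λ'. The real part of that
parameter may be nonpositive, hence the regularized form. -/
theorem tsum_pfaffCoeff_mul_betaIntegral {lam lam' ξ ξ' γ s : ℂ} (hγ : 0 < γ.re) (hs : 0 < s.re)
    (hsum : Summable (fun q : ℕ × ℕ =>
      pfaffCoeff lam lam' ξ ξ' γ q * Complex.betaIntegral (γ + (q.1 + q.2 : ℕ)) s))
    (h1 : 0 < (s + γ - lam - lam' - ξ).re) (h2 : 0 < (s + ξ' - lam').re) :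
    ∑' q : ℕ × ℕ, pfaffCoeff lam lam' ξ ξ' γ q * Complex.betaIntegral (γ + (q.1 + q.2 : ℕ)) s =
      Complex.Gamma γ * gammaQuotient lam lam' ξ ξ' γ s := by
  have e : ∀ q : ℕ × ℕ,
      pfaffCoeff lam lam' ξ ξ' γ q * Complex.betaIntegral (γ + (q.1 + q.2 : ℕ)) s =
      Complex.Gamma γ * Complex.Gamma s * (rising lam q.1 * rising ξ q.1 / q.1 !) *
        gaussTerm lam' (γ - ξ' + q.1) (γ + s + q.1) q.2 := by
    intro q
    have hr := rising_ne_zero hγ (q.1 + q.2)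
    rw [betaIntegral_add_nat hγ hs, pfaffCoeff, gaussTerm,
      show γ + s + ((q.1 + q.2 : ℕ) : ℂ) = γ + s + q.1 + q.2 by push_cast; ring]
    field_simp
  rw [hsum.tsum_prod]
  simp_rw [e, tsum_mul_left]
  have e2 : ∀ m : ℕ, Complex.Gamma γ * Complex.Gamma s * (rising lam m * rising ξ m / m !) *
      ∑' n, gaussTerm lam' (γ - ξ' + m) (γ + s + m) n =
      Complex.Gamma γ * Complex.Gamma s * Complex.Gamma (s + ξ' - lam') *
        (Complex.Gamma (s + ξ'))⁻¹ * gaussTerm lam ξ (γ + s - lam') m := by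
    intro m
    rw [tsum_gaussTerm (by rwa [show γ + s + m - lam' - (γ - ξ' + m) = s + ξ' - lam' by ring]),
      show γ + s + m - lam' - (γ - ξ' + m) = s + ξ' - lam' by ring,
      show γ + s + m - (γ - ξ' + m) = s + ξ' by ring,
      show γ + s + m - lam' = γ + s - lam' + m by ring, gaussTerm]
    ring
  simp_rw [e2, tsum_mul_left]
  rw [tsum_gaussTerm (by rwa [show γ + s - lam' - lam - ξ = s + γ - lam - lam' - ξ by ring]),
    show γ + s - lam' - lam - ξ = s + γ - lam - lam' - ξ by ring,
    show γ + s - lam' - lam = s + γ - lam - lam' by ring,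
    show γ + s - lam' - ξ = s + γ - lam' - ξ by ring, gammaQuotient]
  ring

/-- Taking norms in the integrand replaces γ and s by their real parts in the beta integral, so the
summability of norms reduces to `summable_pfaffCoeff_mul_rpow`. -/
theorem pfaffIntegrand_of_re_pos {lam lam' ξ ξ' γ s : ℂ} (hγ : 0 < γ.re)
    (hlam' : 0 < lam'.re) (hs : 0 < s.re)
    (h1 : 0 < (s + γ - lam - lam' - ξ).re) (h2 : 0 < (s + ξ' - lam').re) :
    IntegrableOn (pfaffIntegrand lam lam' ξ ξ' γ s) (Set.Ioo 0 1) ∧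
      ∫ u in Set.Ioo (0 : ℝ) 1, pfaffIntegrand lam lam' ξ ξ' γ s u =
        Complex.Gamma γ * gammaQuotient lam lam' ξ ξ' γ s := by
  set F : ℕ × ℕ → ℝ → ℂ := fun q u => pfaffCoeff lam lam' ξ ξ' γ q *
    ((u : ℂ) ^ (γ + (q.1 + q.2 : ℕ) - 1) * (1 - (u : ℂ)) ^ (s - 1)) with hF
  have hFint : ∀ q, Integrable (F q) (volume.restrict (Set.Ioo 0 1)) := fun q =>
    Integrable.const_mul ((intervalIntegrable_iff_integrableOn_Ioo_of_le zero_le_one).1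
      (Complex.betaIntegral_convergent (re_add_nat_pos hγ _) hs)) _
  have hFval : ∀ q, ∫ u in Set.Ioo (0 : ℝ) 1, F q u =
      pfaffCoeff lam lam' ξ ξ' γ q * Complex.betaIntegral (γ + (q.1 + q.2 : ℕ)) s := fun q => by
    rw [Complex.betaIntegral, intervalIntegral.integral_of_le zero_le_one,
      integral_Ioc_eq_integral_Ioo, ← integral_const_mul]
  have hFnorm : Summable fun q => ∫ u in Set.Ioo (0 : ℝ) 1, ‖F q u‖ := by
    obtain ⟨C, hC, hb⟩ := norm_betaIntegral_add_nat_le (z := (γ.re : ℂ)) (w := (s.re : ℂ))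
      (by simpa) (by simpa)
    refine .of_nonneg_of_le (fun q => integral_nonneg fun u => norm_nonneg _) (fun q => ?_)
      ((summable_pfaffCoeff_mul_rpow hγ hlam' h1 h2).mul_left C)
    have e : ∫ u in Set.Ioo (0 : ℝ) 1, ‖F q u‖ = ‖pfaffCoeff lam lam' ξ ξ' γ q‖ *
        ‖Complex.betaIntegral ((γ.re : ℂ) + (q.1 + q.2 : ℕ)) (s.re : ℂ)‖ := by
      have := integral_norm_beta_integrand (γ + (q.1 + q.2 : ℕ)) s
      rw [show ((γ + ((q.1 + q.2 : ℕ) : ℂ)).re : ℂ) = (γ.re : ℂ) + ((q.1 + q.2 : ℕ) : ℂ) by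
        simp] at this
      rw [← this, Complex.norm_real, Real.norm_of_nonneg (integral_nonneg fun u => norm_nonneg _),
        ← integral_const_mul]
      simp only [hF, norm_mul]
    rw [e]
    have := hb (q.1 + q.2)
    rw [Complex.ofReal_re] at this
    push_cast at this ⊢
    calc _ ≤ ‖pfaffCoeff lam lam' ξ ξ' γ q‖ * (C * ((q.1 : ℝ) + q.2 + 1) ^ (-s.re)) := by gcongr
      _ = _ := by ring
  have hpt : ∀ u ∈ Set.Ioo (0 : ℝ) 1, Summable (fun q => F q u) ∧
      ∑' q, F q u = pfaffIntegrand lam lam' ξ ξ' γ s u := by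
    intro u hu
    have hu1 : ‖(u : ℂ)‖ < 1 := by
      rw [Complex.norm_real, Real.norm_of_nonneg hu.1.le]; exact hu.2
    have hu0 : (u : ℂ) ≠ 0 := by exact_mod_cast hu.1.ne'
    have e : (fun q => F q u) = fun q : ℕ × ℕ =>
        (u : ℂ) ^ (γ - 1) * (1 - (u : ℂ)) ^ (s - 1) *
          (pfaffCoeff lam lam' ξ ξ' γ q * (u : ℂ) ^ (q.1 + q.2)) := by
      funext q
      simp only [hF]
      rw [show γ + ((q.1 + q.2 : ℕ) : ℂ) - 1 = (γ - 1) + ((q.1 + q.2 : ℕ) : ℂ) by ring,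
        Complex.cpow_add _ _ hu0, Complex.cpow_natCast]
      ring
    rw [e]
    exact ⟨(summable_pfaffDiag lam lam' ξ ξ' hγ hu1).mul_left _, by
      rw [tsum_mul_left, pfaffIntegrand, pfaffDiag]⟩
  have hsum := hasSum_integral_of_summable_integral_norm hFint hFnorm
  have hint := integrable_tsum_of_summable_integral_norm hFint hFnorm
    ((ae_restrict_iff' measurableSet_Ioo).2 (ae_of_all _ fun u hu => (hpt u hu).1))
  refine ⟨(integrableOn_congr_fun (fun u hu => (hpt u hu).2) measurableSet_Ioo).1 hint, ?_⟩
  rw [← setIntegral_congr_fun measurableSet_Ioo (fun u hu => (hpt u hu).2), ← hsum.tsum_eq]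
  simp_rw [hFval] at hsum ⊢
  exact tsum_pfaffCoeff_mul_betaIntegral hγ hs hsum.summable h1 h2

theorem pfaffCoeff_contiguous (lam lam' ξ ξ' : ℂ) {γ : ℂ} (hγ : 0 < γ.re) (m n : ℕ) :
    pfaffCoeff lam lam' ξ ξ' γ (m, n + 1) = pfaffCoeff lam (lam' + 1) ξ ξ' γ (m, n + 1) -
      pfaffCoeff lam (lam' + 1) ξ ξ' γ (m, n) +
        ξ' / γ * pfaffCoeff lam (lam' + 1) ξ (ξ' + 1) (γ + 1) (m, n) := by
  have hγ1 : 0 < (γ + 1).re := by simp; linarith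
  have r1 := rising_ne_zero hγ (m + n)
  have r2 := add_natCast_ne_zero hγ (m + n)
  have r0 : γ ≠ 0 := by simpa using add_natCast_ne_zero hγ 0
  have e : rising (γ + 1) (m + n) = rising γ (m + n) * (γ + (m + n : ℕ)) / γ := by
    rw [← rising_succ, rising_succ_left]; field_simp
  have fm : (m ! : ℂ) ≠ 0 := by exact_mod_cast m.factorial_ne_zero
  have fn : (n ! : ℂ) ≠ 0 := by exact_mod_cast n.factorial_ne_zero
  have fn1 : ((n : ℂ) + 1) ≠ 0 := by exact_mod_cast n.succ_ne_zero
  simp only [pfaffCoeff]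
  rw [← add_assoc m n 1, rising_succ γ, e, rising_succ_left lam', rising_succ (γ - ξ' + m),
    rising_succ (lam' + 1), Nat.factorial_succ, show γ + 1 - (ξ' + 1) = γ - ξ' by ring]
  push_cast at r2 ⊢
  field_simp
  ring

/-- This is arranged for the beta transform: the factor 1 - u is absorbed as s → s + 1 and the
factor u as γ → γ + 1, while λ' rises by one in both terms. -/
theorem pfaffDiag_contiguous (lam lam' ξ ξ' : ℂ) {γ : ℂ} (hγ : 0 < γ.re) {u : ℂ} (hu : ‖u‖ < 1) :
    pfaffDiag lam lam' ξ ξ' γ u = (1 - u) * pfaffDiag lam (lam' + 1) ξ ξ' γ u +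
      ξ' / γ * u * pfaffDiag lam (lam' + 1) ξ (ξ' + 1) (γ + 1) u := by
  have hγ1 : 0 < (γ + 1).re := by simp; linarith
  have s0 := summable_pfaffDiag lam lam' ξ ξ' hγ hu
  have s1 := summable_pfaffDiag lam (lam' + 1) ξ ξ' hγ hu
  have s2 := summable_pfaffDiag lam (lam' + 1) ξ (ξ' + 1) hγ1 hu
  simp only [pfaffDiag]
  rw [s0.tsum_prod, s1.tsum_prod, s2.tsum_prod, ← tsum_mul_left, ← tsum_mul_left,
    ← (s1.prod.mul_left _).tsum_add (s2.prod.mul_left _)]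
  refine tsum_congr fun m => ?_
  have t0 := s0.prod_factor m
  have t1 := s1.prod_factor m
  have t2 := s2.prod_factor m
  have z : ∀ a b c : ℂ, pfaffCoeff lam a ξ b c (m, 0) =
      rising lam m * rising ξ m / (rising c m * m !) := by
    intro a b c; simp [pfaffCoeff]
  -- The n = 0 coefficients depend on neither λ' nor ξ', so they cancel. The rest pairs index n + 1
  -- with index n, as in `pfaffCoeff_contiguous`.
  rw [sub_mul, one_mul, t0.tsum_eq_zero_add]
  nth_rewrite 1 [t1.tsum_eq_zero_add]
  rw [z, z, ← tsum_mul_left, ← tsum_mul_left]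
  have t0' := (summable_nat_add_iff 1).2 t0
  have t1' := (summable_nat_add_iff 1).2 t1
  rw [add_sub_assoc, add_assoc, ← t1'.tsum_sub (t1.mul_left u),
    ← (t1'.sub (t1.mul_left u)).tsum_add (t2.mul_left _)]
  congr 1
  refine tsum_congr fun n => ?_
  rw [pfaffCoeff_contiguous lam lam' ξ ξ' hγ, ← add_assoc m n 1, pow_succ]
  ring

/-- All Gamma factors except Γ(s) and 1/Γ(s+ξ') agree in the three terms. The identity reduces to
splitting the factor s + ξ' into s and ξ'. -/
theorem gammaQuotient_contiguous {lam lam' ξ ξ' γ s : ℂ} (hs : s ≠ 0) :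
    gammaQuotient lam lam' ξ ξ' γ s = gammaQuotient lam (lam' + 1) ξ ξ' γ (s + 1) +
      ξ' * gammaQuotient lam (lam' + 1) ξ (ξ' + 1) (γ + 1) s := by
  simp only [gammaQuotient]
  rw [Complex.one_div_Gamma_eq_self_mul_one_div_Gamma_add_one (s + ξ'), Complex.Gamma_add_one s hs]
  ring_nf

/-- The beta-type transform of `pfaffDiag` is a Gamma quotient. -/
theorem pfaffIntegrand_integrableOn_and_integral {lam lam' ξ ξ' γ s : ℂ} (hγ : 0 < γ.re)
    (hs : 0 < s.re)
    (h1 : 0 < (s + γ - lam - lam' - ξ).re) (h2 : 0 < (s + ξ' - lam').re) :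
    IntegrableOn (pfaffIntegrand lam lam' ξ ξ' γ s) (Set.Ioo 0 1) ∧
      ∫ u in Set.Ioo (0 : ℝ) 1, pfaffIntegrand lam lam' ξ ξ' γ s u =
        Complex.Gamma γ * gammaQuotient lam lam' ξ ξ' γ s := by
  obtain ⟨k, hk⟩ := exists_nat_gt (-lam'.re)
  have hk : 0 < lam'.re + k := by linarith
  -- Each step raises Re λ' by one until it is positive. Both s + γ - λ - λ' - ξ and s + ξ' - λ' are
  -- invariant under the two parameter shifts, so the hypotheses persist.
  induction k generalizing lam' ξ' γ s with
  | zero => exact pfaffIntegrand_of_re_pos hγ (by simpa using hk) hs h1 h2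
  | succ k ih =>
    have hγ1 : 0 < (γ + 1).re := by simp; linarith
    have hl : -(lam' + 1).re < k := by push_cast at hk; simp; linarith
    have hl' : 0 < (lam' + 1).re + k := by push_cast at hk; simp; linarith
    have r0 : γ ≠ 0 := by simpa using add_natCast_ne_zero hγ 0
    have s0 : s ≠ 0 := by simpa using add_natCast_ne_zero hs 0
    obtain ⟨i1, v1⟩ := ih (lam' := lam' + 1) (ξ' := ξ') (γ := γ) (s := s + 1) hγ
      (by simp; linarith) (by rwa [show s + 1 + γ - lam - (lam' + 1) - ξ =
        s + γ - lam - lam' - ξ by ring])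
      (by rwa [show s + 1 + ξ' - (lam' + 1) = s + ξ' - lam' by ring]) hl hl'
    obtain ⟨i2, v2⟩ := ih (lam' := lam' + 1) (ξ' := ξ' + 1) (γ := γ + 1) (s := s) hγ1 hs
      (by rwa [show s + (γ + 1) - lam - (lam' + 1) - ξ = s + γ - lam - lam' - ξ by ring])
      (by rwa [show s + (ξ' + 1) - (lam' + 1) = s + ξ' - lam' by ring]) hl hl'
    have e : ∀ u ∈ Set.Ioo (0 : ℝ) 1, pfaffIntegrand lam (lam' + 1) ξ ξ' γ (s + 1) u +
        ξ' / γ * pfaffIntegrand lam (lam' + 1) ξ (ξ' + 1) (γ + 1) s u =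
        pfaffIntegrand lam lam' ξ ξ' γ s u := by
      intro u hu
      have hu1 : ‖(u : ℂ)‖ < 1 := by
        rw [Complex.norm_real, Real.norm_of_nonneg hu.1.le]; exact hu.2
      have hu0 : (u : ℂ) ≠ 0 := by exact_mod_cast hu.1.ne'
      have hu2 : (1 - (u : ℂ)) ≠ 0 := by
        rw [sub_ne_zero]; exact_mod_cast hu.2.ne'
      simp only [pfaffIntegrand]
      rw [pfaffDiag_contiguous lam lam' ξ ξ' hγ hu1, show s + 1 - 1 = (s - 1) + 1 by ring,
        show γ + 1 - 1 = (γ - 1) + 1 by ring, Complex.cpow_add _ _ hu0, Complex.cpow_add _ _ hu2,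
        Complex.cpow_one, Complex.cpow_one]
      ring
    refine ⟨(integrableOn_congr_fun e measurableSet_Ioo).1 (i1.add (i2.const_mul _)), ?_⟩
    rw [← setIntegral_congr_fun measurableSet_Ioo e, integral_add i1 (i2.const_mul _),
      integral_const_mul, v1, v2,
      gammaQuotient_contiguous (lam' := lam') (ξ' := ξ') s0, Complex.Gamma_add_one _ r0]
    field_simp

/-! ### Pfaff's transformation and the continuation of F₃. -/

theorem norm_rising_le_pow (z : ℂ) :
    ∃ (C : ℝ) (M : ℕ), 0 < C ∧ ∀ n : ℕ, ‖rising z n‖ ≤ C * (n ! * ((n : ℝ) + 1) ^ M) := by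
  obtain ⟨C, hC, h⟩ := norm_rising_le z
  obtain ⟨M, hM⟩ := exists_nat_ge |z.re - 1|
  refine ⟨C, M, hC, fun n => (h n).trans ?_⟩
  have hn : (1 : ℝ) ≤ (n : ℝ) + 1 := by linarith [(Nat.cast_nonneg n : (0 : ℝ) ≤ n)]
  gcongr
  exact rpow_le_pow_of_abs_le hn hM

theorem norm_inv_rising_le_pow {z : ℂ} (hz : 0 < z.re) :
    ∃ (C : ℝ) (M : ℕ), 0 < C ∧
      ∀ n : ℕ, ‖rising z n‖⁻¹ ≤ C * ((n ! : ℝ)⁻¹ * ((n : ℝ) + 1) ^ M) := by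
  obtain ⟨C, hC, h⟩ := le_norm_rising hz
  obtain ⟨M, hM⟩ := exists_nat_ge |-(z.re - 1)|
  refine ⟨C, M, hC, fun n => ?_⟩
  have hn : (1 : ℝ) ≤ (n : ℝ) + 1 := by linarith [(Nat.cast_nonneg n : (0 : ℝ) ≤ n)]
  have hn0 : (0 : ℝ) < (n : ℝ) + 1 := by linarith
  have hr : 0 < ‖rising z n‖ := norm_pos_iff.2 (rising_ne_zero hz n)
  have hf : (0 : ℝ) < n ! := by exact_mod_cast n.factorial_pos
  calc ‖rising z n‖⁻¹ ≤ C * ((n ! : ℝ) * ((n : ℝ) + 1) ^ (z.re - 1))⁻¹ := by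
        rw [← div_eq_mul_inv, inv_eq_one_div, div_le_div_iff₀ hr (by positivity)]
        linarith [h n]
    _ = C * ((n ! : ℝ)⁻¹ * ((n : ℝ) + 1) ^ (-(z.re - 1))) := by
        rw [mul_inv, Real.rpow_neg hn0.le]
    _ ≤ _ := by
        gcongr
        exact rpow_le_pow_of_abs_le hn hM

theorem hasSum_rising_mul_pow (a : ℂ) {v : ℂ} (hv : ‖v‖ < 1) :
    HasSum (fun k : ℕ => rising a k / k ! * v ^ k) ((1 - v) ^ (-a)) := by
  have h := (Complex.one_div_one_sub_cpow_hasFPowerSeriesOnBall_zero a).hasSum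
    (y := v) (by rw [← ENNReal.ofReal_one, Metric.eball_ofReal]; simpa using hv)
  simp only [zero_add] at h
  rw [one_div, ← Complex.cpow_neg] at h
  convert! h using 2 with k
  simp only [FormalMultilinearSeries.ofScalars_apply_eq, smul_eq_mul]
  rw [Ring.choose_eq_smul, Polynomial.descPochhammer_smeval_eq_ascPochhammer,
    Polynomial.ascPochhammer_smeval_eq_eval, rising, smul_eq_mul,
    show a + k - 1 - k + 1 = a by ring]
  ring

theorem tsum_prod_eq_tsum_sum_antidiagonal {f : ℕ × ℕ → ℂ} (hf : Summable f) :
    ∑' q, f q = ∑' N, ∑ q ∈ Finset.HasAntidiagonal.antidiagonal N, f q := by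
  rw [← (Finset.HasAntidiagonal.sigmaAntidiagonalEquivProd (A := ℕ)).tsum_eq f]
  have hs : Summable (fun c => f (Finset.HasAntidiagonal.sigmaAntidiagonalEquivProd (A := ℕ) c)) :=
    (Finset.HasAntidiagonal.sigmaAntidiagonalEquivProd (A := ℕ)).summable_iff.2 hf
  rw [hs.tsum_sigma' fun n => (hasSum_fintype _).summable]
  refine tsum_congr fun N => ?_
  rw [tsum_fintype]
  exact Finset.sum_finset_coe f (Finset.HasAntidiagonal.antidiagonal N)

/-- Pfaff's transformation of the Gauss hypergeometric series, near the origin. -/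
theorem pfaff_transformation (a b : ℂ) {c v : ℂ} (hc : 0 < c.re) (hv : ‖v‖ < 1 / 2) :
    ∑' n : ℕ, rising a n * rising b n / (rising c n * n !) * v ^ n =
      (1 - v) ^ (-a) *
        ∑' n : ℕ, rising a n * rising (c - b) n / (rising c n * n !) * (v / (v - 1)) ^ n := by
  -- This double series comes from expanding (1-v)^(-a-n) on the transformed side. Its rows sum to
  -- that side; its antidiagonals sum to the original series by Chu–Vandermonde.
  set T : ℕ × ℕ → ℂ := fun q => rising a (q.1 + q.2) * rising (c - b) q.1 * (-1) ^ q.1 /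
    (rising c q.1 * (q.1 ! * q.2 !)) * v ^ (q.1 + q.2) with hT
  have hv1 : 1 - v ≠ 0 := by
    intro h
    have : v = 1 := by linear_combination -h
    rw [this] at hv; norm_num at hv
  have hsum : Summable T := by
    obtain ⟨A, L, hA, h1⟩ := norm_rising_le_pow a
    obtain ⟨B, M, hB, h2⟩ := norm_rising_le_pow (c - b)
    obtain ⟨C, N, hC, h3⟩ := norm_inv_rising_le_pow hc
    have hr : 2 * ‖v‖ < 1 := by linarith
    have hg := ((summable_add_one_pow_mul_geometric (by positivity) hr (L + M + N)).mul_of_nonneg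
      (summable_add_one_pow_mul_geometric (by positivity) hr L)
      (fun n => by positivity) (fun n => by positivity)).mul_left (A * B * C)
    refine .of_norm_bounded hg fun q => ?_
    obtain ⟨n, k⟩ := q
    have hn0 : (0 : ℝ) ≤ n := n.cast_nonneg
    have hk0 : (0 : ℝ) ≤ k := k.cast_nonneg
    have fn : (0 : ℝ) < n ! := by exact_mod_cast n.factorial_pos
    have fk : (0 : ℝ) < k ! := by exact_mod_cast k.factorial_pos
    -- The growth 2^(n+k) of the binomial coefficients is why ‖v‖ < 1/2 is imposed.
    have hch : ((n + k)! : ℝ) ≤ 2 ^ (n + k) * (n ! * k !) := by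
      have e := Nat.add_choose_mul_factorial_mul_factorial n k
      have e2 := Nat.choose_le_two_pow (n + k) k
      have : (n + k)! ≤ 2 ^ (n + k) * (n ! * k !) := by
        rw [← e, mul_assoc]; exact Nat.mul_le_mul_right _ e2
      exact_mod_cast this
    simp only [hT]
    rw [norm_mul, norm_div, norm_mul, norm_mul, norm_mul, norm_mul, norm_pow, norm_pow, norm_neg,
      norm_one, one_pow, mul_one, Complex.norm_natCast, Complex.norm_natCast, div_eq_mul_inv,
      mul_inv]
    have h1' := h1 (n + k)
    push_cast at h1'
    calc _ ≤ (A * ((n + k)! * ((n : ℝ) + k + 1) ^ L)) * (B * (n ! * ((n : ℝ) + 1) ^ M)) *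
          ((C * ((n ! : ℝ)⁻¹ * ((n : ℝ) + 1) ^ N)) * ((n ! : ℝ) * k !)⁻¹) * ‖v‖ ^ (n + k) := by
          gcongr
          · exact h2 n
          · exact h3 n
      _ ≤ (A * ((2 ^ (n + k) * (n ! * k !)) * (((n : ℝ) + 1) * ((k : ℝ) + 1)) ^ L)) *
          (B * (n ! * ((n : ℝ) + 1) ^ M)) *
          ((C * ((n ! : ℝ)⁻¹ * ((n : ℝ) + 1) ^ N)) * ((n ! : ℝ) * k !)⁻¹) * ‖v‖ ^ (n + k) := by
          gcongr
          nlinarith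
      _ = _ := by
          rw [mul_pow, mul_pow, mul_pow]
          field_simp
          ring
  have hrow : ∀ n, ∑' k, T (n, k) = (1 - v) ^ (-a) *
      (rising a n * rising (c - b) n / (rising c n * n !) * (v / (v - 1)) ^ n) := by
    intro n
    have hk : ∀ k, T (n, k) = rising a n * rising (c - b) n * (-1) ^ n / (rising c n * n !) *
        v ^ n * (rising (a + n) k / k ! * v ^ k) := by
      intro k
      simp only [hT]
      have fn : (n ! : ℂ) ≠ 0 := by exact_mod_cast n.factorial_ne_zero
      have fk : (k ! : ℂ) ≠ 0 := by exact_mod_cast k.factorial_ne_zero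
      have := rising_ne_zero hc n
      rw [rising_add, pow_add]
      field_simp
    simp_rw [hk]
    rw [tsum_mul_left, (hasSum_rising_mul_pow (a + n) (by linarith)).tsum_eq, neg_add,
      Complex.cpow_add _ _ hv1, Complex.cpow_neg _ (n : ℂ), Complex.cpow_natCast,
      ← neg_sub 1 v, div_neg, neg_pow (v / (1 - v)), div_pow]
    ring
  have hdiag : ∀ N, ∑ q ∈ Finset.HasAntidiagonal.antidiagonal N, T q =
      rising a N * rising b N / (rising c N * N !) * v ^ N := by
    intro N
    have hcv := sum_antidiagonal_rising N (c - b) c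
    rw [sub_sub_cancel] at hcv
    rw [← hcv, Finset.mul_sum, Finset.sum_div, Finset.sum_mul]
    refine Finset.sum_congr rfl fun q hq => ?_
    have hN := Finset.HasAntidiagonal.mem_antidiagonal.1 hq
    have hch : ((N.choose q.1 : ℂ)) * (q.1 ! * q.2 !) = N ! := by
      rw [← hN, Nat.choose_symm_add]
      exact_mod_cast (mul_assoc _ _ _).symm.trans
        (Nat.add_choose_mul_factorial_mul_factorial q.1 q.2)
    have f1 : (q.1 ! : ℂ) ≠ 0 := by exact_mod_cast q.1.factorial_ne_zero
    have f2 : (q.2 ! : ℂ) ≠ 0 := by exact_mod_cast q.2.factorial_ne_zero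
    have fN : (N ! : ℂ) ≠ 0 := by exact_mod_cast N.factorial_ne_zero
    have r1 := rising_ne_zero hc q.1
    have r2 := rising_ne_zero hc N
    simp only [hT]
    rw [← hch] at fN ⊢
    obtain rfl := hN
    rw [rising_add c] at r2 ⊢
    have : rising (c + q.1) q.2 ≠ 0 := right_ne_zero_of_mul r2
    have : ((q.1 + q.2).choose q.1 : ℂ) ≠ 0 := left_ne_zero_of_mul fN
    field_simp
  rw [← tsum_congr hdiag, ← tsum_prod_eq_tsum_sum_antidiagonal hsum, hsum.tsum_prod,
    tsum_congr hrow, tsum_mul_left]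

theorem differentiableOn_double_series {d : ℕ × ℕ → ℂ} {C : ℝ} {M : ℕ}
    (hd : ∀ q, ‖d q‖ ≤ C * (((q.1 : ℝ) + 1) ^ M * ((q.2 : ℝ) + 1) ^ M)) {u : ℂ}
    (hu : ‖u‖ < 1) :
    DifferentiableOn ℂ (fun v : ℂ => ∑' q : ℕ × ℕ, d q * u ^ q.1 * v ^ q.2)
      (Metric.ball 0 1) := by
  intro v hv
  rw [mem_ball_zero_iff] at hv
  obtain ⟨r, hr1, hr2⟩ := exists_between hv
  have hr0 : 0 ≤ r := (norm_nonneg v).trans hr1.le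
  have hs := (summable_double_of_poly_bound hd hu (v := (r : ℂ)) (by
    rwa [Complex.norm_real, Real.norm_of_nonneg hr0])).norm
  have := Complex.differentiableOn_tsum_of_summable_norm hs
    (F := fun q v => d q * u ^ q.1 * v ^ q.2) (U := Metric.ball 0 r)
    (fun q => by fun_prop) Metric.isOpen_ball (fun q w hw => by
      rw [mem_ball_zero_iff] at hw
      rw [norm_mul, norm_mul _ ((r : ℂ) ^ q.2), norm_pow, norm_pow, Complex.norm_real,
        Real.norm_of_nonneg hr0]
      gcongr)
  exact (this.differentiableAt (Metric.isOpen_ball.mem_nhds (by simpa using hr1))).differentiableWithinAt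

/-- The coefficients of Appell's `F₃`. -/
noncomputable def appellF3Coeff (a a' b b' c : ℂ) (q : ℕ × ℕ) : ℂ :=
  (rising a q.1 * rising a' q.2 * rising b q.1 * rising b' q.2) /
    (rising c (q.1 + q.2) * q.1 ! * q.2 !)

theorem appellF3Series_eq (a a' b b' c u v : ℂ) :
    appellF3Series a a' b b' c u v = ∑' q, appellF3Coeff a a' b b' c q * u ^ q.1 * v ^ q.2 := rfl

theorem appellF3Coeff_poly_bound (a a' b b' : ℂ) {c : ℂ} (hc : 0 < c.re) :
    ∃ (C : ℝ) (M : ℕ), ∀ q : ℕ × ℕ, ‖appellF3Coeff a a' b b' c q‖ ≤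
      C * (((q.1 : ℝ) + 1) ^ M * ((q.2 : ℝ) + 1) ^ M) := by
  obtain ⟨A1, L1, hA1, h1⟩ := norm_rising_le_pow a
  obtain ⟨A2, L2, hA2, h2⟩ := norm_rising_le_pow a'
  obtain ⟨A3, L3, hA3, h3⟩ := norm_rising_le_pow b
  obtain ⟨A4, L4, hA4, h4⟩ := norm_rising_le_pow b'
  obtain ⟨A5, L5, hA5, h5⟩ := norm_inv_rising_le_pow hc
  refine ⟨A1 * A2 * A3 * A4 * A5, L1 + L2 + L3 + L4 + L5, fun q => ?_⟩
  obtain ⟨m, n⟩ := q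
  have hm0 : (0 : ℝ) ≤ m := m.cast_nonneg
  have hn0 : (0 : ℝ) ≤ n := n.cast_nonneg
  have fm : (0 : ℝ) < m ! := by exact_mod_cast m.factorial_pos
  have fn : (0 : ℝ) < n ! := by exact_mod_cast n.factorial_pos
  have fN : (0 : ℝ) < (m + n)! := by exact_mod_cast (m + n).factorial_pos
  have hch : (m ! : ℝ) * n ! ≤ (m + n)! := by
    exact_mod_cast Nat.le_of_dvd (Nat.factorial_pos _)
      (Nat.factorial_mul_factorial_dvd_factorial_add m n)
  have h5' := h5 (m + n)
  push_cast at h5'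
  have em : (1 : ℝ) ≤ (m : ℝ) + 1 := by linarith
  have en : (1 : ℝ) ≤ (n : ℝ) + 1 := by linarith
  simp only [appellF3Coeff]
  rw [norm_div, norm_mul, norm_mul, norm_mul, norm_mul, norm_mul, Complex.norm_natCast,
    Complex.norm_natCast, div_eq_mul_inv, mul_assoc ‖rising c (m + n)‖, mul_inv]
  calc _ ≤ (A1 * (m ! * ((m : ℝ) + 1) ^ L1)) * (A2 * (n ! * ((n : ℝ) + 1) ^ L2)) *
        (A3 * (m ! * ((m : ℝ) + 1) ^ L3)) * (A4 * (n ! * ((n : ℝ) + 1) ^ L4)) *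
        ((A5 * ((((m + n)! : ℕ) : ℝ)⁻¹ * ((m : ℝ) + n + 1) ^ L5)) * ((m ! : ℝ) * n !)⁻¹) := by
        gcongr
        · exact h1 m
        · exact h2 n
        · exact h3 m
        · exact h4 n
    _ ≤ (A1 * (m ! * ((m : ℝ) + 1) ^ L1)) * (A2 * (n ! * ((n : ℝ) + 1) ^ L2)) *
        (A3 * (m ! * ((m : ℝ) + 1) ^ L3)) * (A4 * (n ! * ((n : ℝ) + 1) ^ L4)) *
        ((A5 * (((m ! : ℝ) * n !)⁻¹ * (((m : ℝ) + 1) * ((n : ℝ) + 1)) ^ L5)) *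
          ((m ! : ℝ) * n !)⁻¹) := by
        gcongr
        nlinarith
    _ = A1 * A2 * A3 * A4 * A5 * (((m : ℝ) + 1) ^ (L1 + L3 + L5) *
          ((n : ℝ) + 1) ^ (L2 + L4 + L5)) := by
        rw [mul_pow]
        field_simp
        ring
    _ ≤ _ := by
        refine mul_le_mul_of_nonneg_left (mul_le_mul (pow_le_pow_right₀ em (by omega))
          (pow_le_pow_right₀ en (by omega)) (by positivity) (by positivity)) (by positivity)

/-- The Pfaff-transformed form of `F₃`, valid for `Re v < 1 / 2`. -/
noncomputable def appellF3Pfaff (a a' b b' c u v : ℂ) : ℂ :=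
  (1 - v) ^ (-a') * ∑' q : ℕ × ℕ, pfaffCoeff a a' b b' c q * u ^ q.1 * (v / (v - 1)) ^ q.2

/-- The half-plane Re v < 1/2 consists of the points closer to 0 than to 1. -/
theorem norm_div_sub_one_lt_one {v : ℂ} (hv : v.re < 1 / 2) : ‖v / (v - 1)‖ < 1 := by
  have h1 : v - 1 ≠ 0 := by
    intro h
    have : v = 1 := by linear_combination h
    rw [this] at hv; norm_num at hv
  rw [norm_div, div_lt_one (norm_pos_iff.2 h1), Complex.norm_eq_sqrt_sq_add_sq,
    Complex.norm_eq_sqrt_sq_add_sq]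
  refine Real.sqrt_lt_sqrt (by positivity) ?_
  simp only [Complex.sub_re, Complex.one_re, Complex.sub_im, Complex.one_im, sub_zero]
  nlinarith

/-- For each fixed m, the sum over n is a Gauss series in v with lower parameter c + m, to which
Pfaff's transformation applies. The prefactor (1-v)^(-a') does not depend on m. -/
theorem appellF3Series_eq_pfaff (a a' b b' : ℂ) {c u v : ℂ} (hc : 0 < c.re) (hu : ‖u‖ < 1)
    (hv : ‖v‖ < 1 / 2) : appellF3Series a a' b b' c u v = appellF3Pfaff a a' b b' c u v := by
  have hw := norm_div_sub_one_lt_one ((Complex.re_le_norm v).trans_lt hv)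
  obtain ⟨C, M, hd⟩ := appellF3Coeff_poly_bound a a' b b' hc
  have s1 := summable_double_of_poly_bound hd hu (v := v) (by linarith)
  have s2 := summable_pfaffCoeff a a' b b' hc hu hw
  rw [appellF3Series_eq, appellF3Pfaff, s1.tsum_prod, s2.tsum_prod, ← tsum_mul_left]
  refine tsum_congr fun m => ?_
  have hcm := re_add_nat_pos hc m
  have r0 := rising_ne_zero hc m
  have fm : (m ! : ℂ) ≠ 0 := by exact_mod_cast m.factorial_ne_zero
  have e1 : ∀ n : ℕ, appellF3Coeff a a' b b' c (m, n) * u ^ m * v ^ n =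
      rising a m * rising b m / (rising c m * m !) * u ^ m *
        (rising a' n * rising b' n / (rising (c + m) n * n !) * v ^ n) := by
    intro n
    have r1 := rising_ne_zero hcm n
    have fn : (n ! : ℂ) ≠ 0 := by exact_mod_cast n.factorial_ne_zero
    simp only [appellF3Coeff]
    rw [rising_add]
    field_simp
  have e2 : ∀ n : ℕ, pfaffCoeff a a' b b' c (m, n) * u ^ m * (v / (v - 1)) ^ n =
      rising a m * rising b m / (rising c m * m !) * u ^ m *
        (rising a' n * rising (c + m - b') n / (rising (c + m) n * n !) * (v / (v - 1)) ^ n) := by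
    intro n
    have r1 := rising_ne_zero hcm n
    have fn : (n ! : ℂ) ≠ 0 := by exact_mod_cast n.factorial_ne_zero
    simp only [pfaffCoeff]
    rw [rising_add c, show c - b' + m = c + m - b' by ring]
    field_simp
  simp_rw [e1, e2, tsum_mul_left]
  rw [pfaff_transformation a' b' hcm hv]
  ring

theorem differentiableOn_appellF3Pfaff (a a' b b' : ℂ) {c u : ℂ} (hc : 0 < c.re) (hu : ‖u‖ < 1) :
    DifferentiableOn ℂ (appellF3Pfaff a a' b b' c u) {v | v.re < 1 / 2} := by
  obtain ⟨C, M, hd⟩ := pfaffCoeff_poly_bound a a' b b' hc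
  have h := differentiableOn_double_series hd hu
  have hne : ∀ v ∈ {v : ℂ | v.re < 1 / 2}, v - 1 ≠ 0 := by
    intro v hv h
    have : v = 1 := by linear_combination h
    rw [this] at hv; norm_num at hv
  refine DifferentiableOn.mul ?_ ?_
  · refine DifferentiableOn.cpow_const (by fun_prop) fun v hv => ?_
    left
    have : v.re < 1 / 2 := hv
    simp only [Complex.sub_re, Complex.one_re]; linarith
  · refine h.comp (f := fun v => v / (v - 1))
      (DifferentiableOn.div (by fun_prop) (by fun_prop) hne) fun v hv => ?_
    rw [mem_ball_zero_iff]
    exact norm_div_sub_one_lt_one hv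

theorem analyticAt_comp_ofReal {f : ℂ → ℂ} {U : Set ℂ} (hf : DifferentiableOn ℂ f U)
    (hU : IsOpen U) {v : ℝ} (hv : (v : ℂ) ∈ U) : AnalyticAt ℝ (fun t : ℝ => f t) v := by
  have h1 : AnalyticAt ℝ f (v : ℂ) := (hf.analyticAt (hU.mem_nhds hv)).restrictScalars
  exact h1.fun_comp (Complex.ofRealCLM.analyticAt v)

/-- Two analytic pieces are glued: the Pfaff form on v < 1/2 and the double series on (-1, 1). They
agree near 0, hence on the whole overlap by the identity theorem. -/
theorem isAppellF3Continuation_pfaff (a a' b b' : ℂ) {c u : ℂ} (hc : 0 < c.re) (hu : ‖u‖ < 1) :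
    IsAppellF3Continuation a a' b b' c u (fun v : ℝ =>
      if v < 1 / 2 then appellF3Pfaff a a' b b' c u v else appellF3Series a a' b b' c u v) := by
  obtain ⟨C, M, hd⟩ := appellF3Coeff_poly_bound a a' b b' hc
  have hser := differentiableOn_double_series hd hu
  have hpf := differentiableOn_appellF3Pfaff a a' b b' hc hu
  have hU : IsOpen {v : ℂ | v.re < 1 / 2} := isOpen_lt Complex.continuous_re continuous_const
  have a1 : ∀ v ∈ Set.Ioo (-1 : ℝ) 1, AnalyticAt ℝ
      (fun t : ℝ => appellF3Series a a' b b' c u t) v := fun v hv =>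
    analyticAt_comp_ofReal hser Metric.isOpen_ball (by
      rw [mem_ball_zero_iff, Complex.norm_real, Real.norm_eq_abs, abs_lt]; exact hv)
  have a2 : ∀ v < (1 / 2 : ℝ), AnalyticAt ℝ
      (fun t : ℝ => appellF3Pfaff a a' b b' c u t) v := fun v hv =>
    analyticAt_comp_ofReal hpf hU (by simpa using hv)
  have heq : Set.EqOn (fun t : ℝ => appellF3Series a a' b b' c u t)
      (fun t : ℝ => appellF3Pfaff a a' b b' c u t) (Set.Ioo (-1) (1 / 2)) := by
    refine AnalyticOnNhd.eqOn_of_preconnected_of_eventuallyEq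
      (fun v hv => a1 v ⟨hv.1, hv.2.trans (by norm_num)⟩) (fun v hv => a2 v hv.2)
      isPreconnected_Ioo (z₀ := 0) (by norm_num) ?_
    filter_upwards [Ioo_mem_nhds (show (-(1 / 2) : ℝ) < 0 by norm_num)
      (show (0 : ℝ) < 1 / 2 by norm_num)] with v hv
    exact appellF3Series_eq_pfaff a a' b b' hc hu (by
      rw [Complex.norm_real, Real.norm_eq_abs, abs_lt]; exact hv)
  have heq' : Set.EqOn (fun v : ℝ => if v < 1 / 2 then appellF3Pfaff a a' b b' c u v
      else appellF3Series a a' b b' c u v) (fun t : ℝ => appellF3Series a a' b b' c u t)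
      (Set.Ioo (-1) 1) := by
    intro v hv
    by_cases h : v < 1 / 2
    · simp only [if_pos h]; exact (heq ⟨hv.1, h⟩).symm
    · simp only [if_neg h]
  refine ⟨fun v hv => ?_, heq'⟩
  by_cases h : v < 1 / 2
  · refine (a2 v h).congr ?_
    filter_upwards [Iio_mem_nhds h] with t ht
    rw [if_pos (show t < 1 / 2 from ht)]
  · have hv' : v ∈ Set.Ioo (-1 : ℝ) 1 := ⟨by linarith, hv⟩
    exact (a1 v hv').congr ((heq'.symm).eventuallyEq_of_mem (Ioo_mem_nhds hv'.1 hv'.2))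

theorem appellF3_eq_pfaff (a a' b b' : ℂ) {c u : ℂ} (hc : 0 < c.re) (hu : ‖u‖ < 1) {v : ℝ}
    (hv : v < 1 / 2) : appellF3 a a' b b' c u v = appellF3Pfaff a a' b b' c u v := by
  have hg := isAppellF3Continuation_pfaff a a' b b' hc hu
  have hex : ∃ g : ℝ → ℂ, IsAppellF3Continuation a a' b b' c u g := ⟨_, hg⟩
  have := hex.choose_spec.eqOn hg (show v ∈ Set.Iio 1 from hv.trans (by norm_num))
  rw [appellF3, dif_pos hex, this, if_pos hv]

/-! ### Images of powers under the fractional integral. -/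

/-- On `(0, x)` the Marichev–Saigo–Maeda kernel is a power times `pfaffDiag`. -/
theorem msmIntegrand_eq (lam lam' ξ ξ' : ℂ) {γ : ℂ} (hγ : 0 < γ.re) (f : ℝ → ℂ) {x t : ℝ}
    (hx : 0 < x) (ht : t ∈ Set.Ioo 0 x) :
    msmIntegrand lam lam' ξ ξ' γ f x t = (x : ℂ) ^ (-lam') * ((x - t : ℝ) : ℂ) ^ (γ - 1) *
      pfaffDiag lam lam' ξ ξ' γ ((1 - t / x : ℝ) : ℂ) * f t := by
  have ht0 := ht.1
  have htx : t / x < 1 := (div_lt_one hx).2 ht.2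
  have htx0 : 0 < t / x := div_pos ht0 hx
  have hxt : 1 < x / t := (one_lt_div ht0).2 ht.2
  have hu : ‖((1 - t / x : ℝ) : ℂ)‖ < 1 := by
    rw [Complex.norm_real, Real.norm_eq_abs, abs_lt]; constructor <;> linarith
  have e1 : (1 - ((1 - x / t : ℝ) : ℂ)) = ((x / t : ℝ) : ℂ) := by push_cast; ring
  have xc : (x : ℂ) ≠ 0 := by exact_mod_cast hx.ne'
  have tc : (t : ℂ) ≠ 0 := by exact_mod_cast ht0.ne'
  -- The key coincidence: the transformed second variable equals the first, so the double series is
  -- evaluated on its diagonal.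
  have e2 : ((1 - x / t : ℝ) : ℂ) / (((1 - x / t : ℝ) : ℂ) - 1) = ((1 - t / x : ℝ) : ℂ) := by
    push_cast
    have : (1 - (x : ℂ) / t - 1) ≠ 0 := by
      rw [show (1 - (x : ℂ) / t - 1) = -(x / t) by ring]
      exact neg_ne_zero.2 (div_ne_zero xc tc)
    rw [div_eq_iff this]
    field_simp
    ring
  have e3 : (t : ℂ) ^ (-lam') * ((x / t : ℝ) : ℂ) ^ (-lam') = (x : ℂ) ^ (-lam') := by
    rw [← Complex.mul_cpow_ofReal_nonneg ht0.le (div_pos hx ht0).le, ← Complex.ofReal_mul,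
      mul_div_cancel₀ _ ht0.ne']
  rw [msmIntegrand, appellF3_eq_pfaff lam lam' ξ ξ' hγ hu (by linarith), appellF3Pfaff, e1, e2,
    pfaffDiag, ← e3]
  simp only [pow_add, mul_assoc]
  ring

theorem msmIntegrand_cpow_eq (lam lam' ξ ξ' s : ℂ) {γ : ℂ} (hγ : 0 < γ.re) {x t : ℝ}
    (hx : 0 < x) (ht : t ∈ Set.Ioo 0 x) :
    msmIntegrand lam lam' ξ ξ' γ (fun t : ℝ => (t : ℂ) ^ (s - 1)) x t =
      (x : ℂ) ^ (s + γ - lam' - 2) * pfaffIntegrand lam lam' ξ ξ' γ s (1 - t / x) := by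
  have htx : t / x < 1 := (div_lt_one hx).2 ht.2
  have htx0 : 0 < t / x := div_pos ht.1 hx
  have xc : (x : ℂ) ≠ 0 := by exact_mod_cast hx.ne'
  have e1 : ((x - t : ℝ) : ℂ) ^ (γ - 1) =
      (x : ℂ) ^ (γ - 1) * ((1 - t / x : ℝ) : ℂ) ^ (γ - 1) := by
    rw [← Complex.mul_cpow_ofReal_nonneg hx.le (by linarith), ← Complex.ofReal_mul, mul_sub,
      mul_one, mul_div_cancel₀ _ hx.ne']
  have e2 : (t : ℂ) ^ (s - 1) = (x : ℂ) ^ (s - 1) * ((t / x : ℝ) : ℂ) ^ (s - 1) := by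
    rw [← Complex.mul_cpow_ofReal_nonneg hx.le htx0.le, ← Complex.ofReal_mul,
      mul_div_cancel₀ _ hx.ne']
  have e3 : (1 - ((1 - t / x : ℝ) : ℂ)) = ((t / x : ℝ) : ℂ) := by push_cast; ring
  rw [msmIntegrand_eq lam lam' ξ ξ' hγ _ hx ht, pfaffIntegrand, e1, e2, e3,
    show s + γ - lam' - 2 = (s - 1) + (γ - 1) + -lam' by ring, Complex.cpow_add _ _ xc,
    Complex.cpow_add _ _ xc]
  ring

/-- The image of a power function under the Marichev–Saigo–Maeda integral, before
normalization. -/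
theorem msmIntegrand_cpow {lam lam' ξ ξ' γ s : ℂ} (hγ : 0 < γ.re) (hs : 0 < s.re)
    (h1 : 0 < (s + γ - lam - lam' - ξ).re) (h2 : 0 < (s + ξ' - lam').re) {x : ℝ} (hx : 0 < x) :
    IntegrableOn (msmIntegrand lam lam' ξ ξ' γ (fun t : ℝ => (t : ℂ) ^ (s - 1)) x)
      (Set.Ioo 0 x) ∧
    ∫ t in Set.Ioo 0 x, msmIntegrand lam lam' ξ ξ' γ (fun t : ℝ => (t : ℂ) ^ (s - 1)) x t =
      (x : ℂ) ^ (s + γ - lam' - 1) *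
        (Complex.Gamma γ * gammaQuotient lam lam' ξ ξ' γ s) := by
  obtain ⟨hi, hv⟩ := pfaffIntegrand_integrableOn_and_integral (lam := lam) hγ hs h1 h2
  have xc : (x : ℂ) ≠ 0 := by exact_mod_cast hx.ne'
  have hcongr : ∀ t ∈ Set.Ioo 0 x,
      (x : ℂ) ^ (s + γ - lam' - 2) * pfaffIntegrand lam lam' ξ ξ' γ s (1 - t / x) =
      msmIntegrand lam lam' ξ ξ' γ (fun t : ℝ => (t : ℂ) ^ (s - 1)) x t := fun t ht =>
    (msmIntegrand_cpow_eq lam lam' ξ ξ' s hγ hx ht).symm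
  have hI : IntegrableOn (fun t => pfaffIntegrand lam lam' ξ ξ' γ s (1 - t / x))
      (Set.Ioo 0 x) := by
    rw [← intervalIntegrable_iff_integrableOn_Ioo_of_le hx.le]
    have h := (((intervalIntegrable_iff_integrableOn_Ioo_of_le zero_le_one).2 hi).comp_sub_left
      1).symm.comp_mul_left (c := x⁻¹)
    simpa [inv_mul_eq_div] using h
  refine ⟨(integrableOn_congr_fun hcongr measurableSet_Ioo).1 (hI.const_mul _), ?_⟩
  rw [← setIntegral_congr_fun measurableSet_Ioo hcongr, integral_const_mul,
    ← integral_Ioc_eq_integral_Ioo, ← intervalIntegral.integral_of_le hx.le,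
    intervalIntegral.integral_comp_sub_div (pfaffIntegrand lam lam' ξ ξ' γ s) hx.ne' 1]
  rw [zero_div, sub_zero, div_self hx.ne', sub_self, intervalIntegral.integral_of_le zero_le_one,
    integral_Ioc_eq_integral_Ioo, hv, Complex.real_smul,
    show s + γ - lam' - 1 = (s + γ - lam' - 2) + 1 by ring, Complex.cpow_add _ _ xc,
    Complex.cpow_one]
  ring

/-! ### Decay of 1/Γ and the Struve series. -/

theorem factorial_le_norm_rising {z : ℂ} (hz : 1 ≤ z.re) (n : ℕ) : (n ! : ℝ) ≤ ‖rising z n‖ := by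
  rw [rising_eq_prod, norm_prod, ← Finset.prod_range_add_one_eq_factorial]
  push_cast
  refine Finset.prod_le_prod (fun _ _ => by positivity) fun j _ => ?_
  refine le_trans ?_ (Complex.re_le_norm _)
  simp; linarith

/-- Factorial decay of `1 / Γ` along right half-lines. -/
theorem norm_inv_Gamma_ofReal_add_le (μ : ℂ) :
    ∃ (C : ℝ) (j : ℕ), 0 < C ∧ ∀ y : ℝ, 0 ≤ y →
      ‖(Complex.Gamma (y + μ))⁻¹‖ ≤ C * (((⌊y⌋₊ - j)! : ℕ) : ℝ)⁻¹ := by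
  obtain ⟨j, hj⟩ := exists_nat_ge (1 - μ.re)
  have hcont : Continuous fun y : ℝ => (Complex.Gamma (y + μ))⁻¹ :=
    Complex.differentiable_one_div_Gamma.continuous.comp (by fun_prop)
  obtain ⟨C, hC⟩ := (isCompact_Icc (a := (0 : ℝ)) (b := j + 1)).exists_bound_of_continuousOn
    hcont.continuousOn
  refine ⟨max C 1, j, by positivity, fun y hy => ?_⟩
  -- Stepping back n units puts y - n in the compact interval [0, j+1], where 1/Γ is bounded. If n >
  -- 0 then Re(y - n + μ) ≥ 1, so the rising factorial is at least n!. The truncated subtraction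
  -- gives n = 0 for small y, where the bound is trivial.
  set n := ⌊y⌋₊ - j with hn
  have hf1 := Nat.floor_le hy
  have hf2 := Nat.lt_floor_add_one y
  have hfl : (⌊y⌋₊ : ℝ) ≤ n + j := by exact_mod_cast (by omega : ⌊y⌋₊ ≤ n + j)
  have hn0 : (n : ℝ) ≤ ⌊y⌋₊ := by exact_mod_cast Nat.sub_le _ _
  have hmem : y - n ∈ Set.Icc (0 : ℝ) (j + 1) := ⟨by linarith, by linarith⟩
  have hb := hC _ hmem
  have hfac : (n ! : ℝ) ≤ ‖rising (((y - n : ℝ) : ℂ) + μ) n‖ := by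
    rcases Nat.eq_zero_or_pos n with h0 | h0
    · simp [h0]
    · refine factorial_le_norm_rising ?_ n
      have : (n : ℝ) + j = ⌊y⌋₊ := by exact_mod_cast (by omega : n + j = ⌊y⌋₊)
      simp only [Complex.add_re, Complex.ofReal_re]
      linarith
  have hG := inv_Gamma_eq_rising_mul (((y - n : ℝ) : ℂ) + μ) n
  rw [show ((y - n : ℝ) : ℂ) + μ + n = y + μ by push_cast; ring] at hG
  have hfp : (0 : ℝ) < n ! := by exact_mod_cast n.factorial_pos
  rw [hG, norm_mul] at hb
  rw [← div_eq_mul_inv, le_div_iff₀ hfp]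
  calc ‖(Complex.Gamma (y + μ))⁻¹‖ * n !
      ≤ ‖(Complex.Gamma (y + μ))⁻¹‖ * ‖rising (((y - n : ℝ) : ℂ) + μ) n‖ := by gcongr
    _ ≤ C := by rw [mul_comm]; exact hb
    _ ≤ _ := le_max_left _ _

/-- `∑ Rᵏ / Γ(α k + μ)` converges absolutely for every `R`. -/
theorem summable_norm_inv_Gamma_mul_pow {α : ℝ} (hα : 0 < α) (μ : ℂ) {R : ℝ} (hR : 0 ≤ R) :
    Summable fun k : ℕ => ‖(Complex.Gamma ((α : ℂ) * k + μ))⁻¹‖ * R ^ k := by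
  obtain ⟨C, j, hC, h⟩ := norm_inv_Gamma_ofReal_add_le μ
  -- The 2 in T leaves a factor 2^(-k) for the geometric comparison. With Q = T^(1/α), T^k is at
  -- most Q^(n+j+1), and Q^n/n! ≤ e^Q absorbs the growth.
  set T : ℝ := max (2 * R) 1 with hT
  have hT1 : 1 ≤ T := le_max_right _ _
  have hT0 : 0 < T := by linarith
  set Q : ℝ := T ^ (1 / α) with hQ
  have hQ1 : 1 ≤ Q := Real.one_le_rpow hT1 (by positivity)
  refine .of_nonneg_of_le (fun k => by positivity) (fun k => ?_)
    ((summable_geometric_of_lt_one (r := (1 / 2 : ℝ)) (by norm_num) (by norm_num)).mul_left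
      (C * (Real.exp Q * Q ^ (j + 1))))
  have hk := h (α * k) (by positivity)
  push_cast at hk
  set n := ⌊α * (k : ℝ)⌋₊ - j with hn
  have hfp : (0 : ℝ) < n ! := by exact_mod_cast n.factorial_pos
  have hTk : T ^ k ≤ Q ^ (n + (j + 1)) := by
    have e : T = Q ^ α := by rw [hQ, ← Real.rpow_mul hT0.le, one_div_mul_cancel hα.ne', Real.rpow_one]
    rw [e, ← Real.rpow_natCast, ← Real.rpow_mul (by linarith), ← Real.rpow_natCast]
    refine Real.rpow_le_rpow_of_exponent_le hQ1 ?_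
    have hf2 := Nat.lt_floor_add_one (α * (k : ℝ))
    have hfl : (⌊α * (k : ℝ)⌋₊ : ℝ) ≤ n + j := by exact_mod_cast (by omega : _ ≤ n + j)
    push_cast; linarith
  have hexp := Real.pow_div_factorial_le_exp Q (by linarith) n
  have hR2 : R ^ k ≤ T ^ k * (1 / 2) ^ k := by
    rw [← mul_pow]
    gcongr
    have : 2 * R ≤ T := le_max_left _ _
    linarith
  calc _ ≤ (C * (n ! : ℝ)⁻¹) * (Q ^ (n + (j + 1)) * (1 / 2) ^ k) := by
        gcongr
        exact hR2.trans (by gcongr)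
    _ = C * ((Q ^ n / n !) * Q ^ (j + 1)) * (1 / 2) ^ k := by rw [pow_add]; ring
    _ ≤ _ := by gcongr

/-- The coefficients of the Struve series, after removing the factor `(z / 2) ^ (p + 1)`. -/
noncomputable def struveCoeff (a : ℕ) (α : ℝ) (μ q c : ℂ) (k : ℕ) : ℂ :=
  (-c) ^ k / (Complex.Gamma ((α : ℂ) * k + μ) * Complex.Gamma ((a : ℂ) * k + q)) / 4 ^ k

/-- All the decay needed comes from 1/Γ(αk + μ). The other reciprocal Gamma is only bounded, since a
may be 0. -/
theorem summable_struveCoeff (a : ℕ) {α : ℝ} (hα : 0 < α) (μ q c : ℂ) {R : ℝ} (hR : 0 ≤ R) :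
    Summable fun k : ℕ => ‖struveCoeff a α μ q c k‖ * R ^ k := by
  obtain ⟨C, j, hC, h⟩ := norm_inv_Gamma_ofReal_add_le q
  refine .of_nonneg_of_le (fun k => by positivity) (fun k => ?_)
    ((summable_norm_inv_Gamma_mul_pow hα μ (R := ‖c‖ * R) (by positivity)).mul_left C)
  have hk := h ((a : ℝ) * k) (by positivity)
  push_cast at hk
  have hk' : ‖(Complex.Gamma ((a : ℂ) * k + q))⁻¹‖ ≤ C := by
    refine hk.trans (mul_le_of_le_one_right hC.le (inv_le_one_of_one_le₀ ?_))
    exact_mod_cast Nat.factorial_pos _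
  have h4 : ((4 : ℝ) ^ k)⁻¹ ≤ 1 := inv_le_one_of_one_le₀ (one_le_pow₀ (by norm_num))
  have e : struveCoeff a α μ q c k = (-c) ^ k * ((Complex.Gamma ((α : ℂ) * k + μ))⁻¹ *
      (Complex.Gamma ((a : ℂ) * k + q))⁻¹) * ((4 : ℂ) ^ k)⁻¹ := by
    rw [struveCoeff, div_eq_mul_inv, div_eq_mul_inv, mul_inv]
  have h4' : ‖((4 : ℂ) ^ k)⁻¹‖ = ((4 : ℝ) ^ k)⁻¹ := by simp
  rw [e, norm_mul, norm_mul, norm_mul, norm_pow, norm_neg, h4', mul_pow]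
  calc _ ≤ ‖c‖ ^ k * (‖(Complex.Gamma ((α : ℂ) * k + μ))⁻¹‖ * C) * 1 * R ^ k := by gcongr
    _ = _ := by ring

theorem struveTerm_eq (a : ℕ) (α : ℝ) (μ p b c σ : ℂ) {t : ℝ} (ht : 0 < t) (k : ℕ) :
    struveTerm a α μ p b c σ t k = (t : ℂ) ^ (p + 1) / 2 ^ (p + 1) *
      (struveCoeff a α μ (p / σ + (b + 2) / 2) c k * ((t : ℂ) ^ 2) ^ k) := by
  have tc : (t : ℂ) / 2 ≠ 0 := div_ne_zero (by exact_mod_cast ht.ne') two_ne_zero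
  have e : ((t : ℂ) / 2) ^ (p + 1) = (t : ℂ) ^ (p + 1) / 2 ^ (p + 1) := by
    have := Complex.div_cpow_ofReal_nonneg ht.le zero_le_two (p + 1)
    simpa using this
  have e2 : ((t : ℂ) / 2) ^ (2 * (k : ℂ)) = ((t : ℂ) ^ 2) ^ k / 4 ^ k := by
    rw [show 2 * (k : ℂ) = ((2 * k : ℕ) : ℂ) by push_cast; rfl, Complex.cpow_natCast, pow_mul,
      div_pow, div_pow]
    norm_num
  rw [struveTerm, struveCoeff, add_assoc (2 * (k : ℂ)), Complex.cpow_add _ _ tc, e, e2,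
    add_assoc ((a : ℂ) * k)]
  ring

theorem summable_struveCoeff_mul_pow (a : ℕ) {α : ℝ} (hα : 0 < α) (μ q c z : ℂ) :
    Summable fun k : ℕ => struveCoeff a α μ q c k * z ^ k := by
  refine .of_norm ((summable_struveCoeff a hα μ q c (norm_nonneg z)).congr fun k => ?_)
  rw [norm_mul, norm_pow]

/-- Multiplying a power by the Struve series inside the Marichev–Saigo–Maeda integrand. -/
theorem hasSum_msmIntegrand_struve (lam lam' ξ ξ' γ ρ : ℂ) (a : ℕ) {α : ℝ} (hα : 0 < α)
    (μ p b c σ : ℂ) {x t : ℝ} (ht : 0 < t) :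
    HasSum (fun k : ℕ => struveCoeff a α μ (p / σ + (b + 2) / 2) c k *
        msmIntegrand lam lam' ξ ξ' γ (fun t : ℝ => (t : ℂ) ^ (ρ + p + 1 + 2 * k - 1)) x t)
      ((2 : ℂ) ^ (p + 1) * msmIntegrand lam lam' ξ ξ' γ
        (fun t : ℝ => (t : ℂ) ^ (ρ - 1) * generalizedStruve a α μ p b c σ (t : ℂ)) x t) := by
  have tc : (t : ℂ) ≠ 0 := by exact_mod_cast ht.ne'
  have h2 : (2 : ℂ) ^ (p + 1) ≠ 0 := by simp [Complex.cpow_eq_zero_iff]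
  have hs := (summable_struveCoeff_mul_pow a hα μ (p / σ + (b + 2) / 2) c ((t : ℂ) ^ 2)).hasSum
  have e : generalizedStruve a α μ p b c σ (t : ℂ) = (t : ℂ) ^ (p + 1) / 2 ^ (p + 1) *
      ∑' k : ℕ, struveCoeff a α μ (p / σ + (b + 2) / 2) c k * ((t : ℂ) ^ 2) ^ k := by
    rw [generalizedStruve, ← tsum_mul_left]
    exact tsum_congr fun k => struveTerm_eq a α μ p b c σ ht k
  simp only [msmIntegrand]
  rw [e]
  convert! hs.mul_left ((((x - t : ℝ) : ℂ) ^ (γ - 1) * (t : ℂ) ^ (-lam') *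
    appellF3 lam lam' ξ ξ' γ ((1 - t / x : ℝ) : ℂ) (1 - x / t)) *
      ((t : ℂ) ^ (ρ - 1) * (t : ℂ) ^ (p + 1))) using 1
  · funext k
    rw [show ρ + p + 1 + 2 * (k : ℂ) - 1 = (ρ - 1) + (p + 1) + ((2 * k : ℕ) : ℂ) by
      push_cast; ring, Complex.cpow_add _ _ tc, Complex.cpow_add _ _ tc, Complex.cpow_natCast,
      pow_mul]
    ring
  · generalize appellF3 lam lam' ξ ξ' γ ((1 - t / x : ℝ) : ℂ) (1 - x / t) = Φ
    field_simp

/-! ### The Fox–Wright form and the interchange of sum and integral. -/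

/-- The upper pair (1, 1) contributes Γ(1+k) = k!, cancelling the factorial of the Fox–Wright
series. The six pairs with slope 2 form the Gamma quotient at s = ρ + p + 1 + 2k. -/
theorem foxWrightTerm_image_eq (lam lam' ξ ξ' γ ρ : ℂ) (a : ℕ) (α : ℝ) (μ p b c σ : ℂ) (x : ℝ)
    (k : ℕ) :
    foxWrightTerm (imageUpper lam lam' ξ ξ' γ ρ p) (imageLower lam lam' ξ ξ' γ ρ a α μ p b σ)
        (-(c * (x : ℂ) ^ 2) / 4) k =
      struveCoeff a α μ (p / σ + (b + 2) / 2) c k *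
        (((x : ℂ) ^ 2) ^ k * gammaQuotient lam lam' ξ ξ' γ (ρ + p + 1 + 2 * k)) := by
  have hfac : Complex.Gamma (1 + (k : ℂ)) = k ! := by
    rw [add_comm, Complex.Gamma_nat_eq_factorial]
  have fk : (k ! : ℂ) ≠ 0 := by exact_mod_cast k.factorial_ne_zero
  simp only [foxWrightTerm, imageUpper, imageLower, Fin.prod_univ_four, Fin.prod_univ_five,
    Matrix.cons_val, Complex.ofReal_ofNat, Complex.ofReal_one, one_mul, Complex.ofReal_natCast,
    hfac, struveCoeff, gammaQuotient]
  rw [show ρ + p + 1 + γ - lam - lam' - ξ + 2 * (k : ℂ) =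
      ρ + p + 1 + 2 * k + γ - lam - lam' - ξ by ring,
    show ρ + p + 1 + ξ' - lam' + 2 * (k : ℂ) = ρ + p + 1 + 2 * k + ξ' - lam' by ring,
    show ρ + p + 1 + ξ' + 2 * (k : ℂ) = ρ + p + 1 + 2 * k + ξ' by ring,
    show ρ + p + 1 + γ - lam - lam' + 2 * (k : ℂ) = ρ + p + 1 + 2 * k + γ - lam - lam' by ring,
    show ρ + p + 1 + γ - lam' - ξ + 2 * (k : ℂ) = ρ + p + 1 + 2 * k + γ - lam' - ξ by ring,
    show μ + (α : ℂ) * k = α * k + μ by ring,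
    show p / σ + (b + 2) / 2 + (a : ℂ) * k = a * k + (p / σ + (b + 2) / 2) by ring,
    show -(c * (x : ℂ) ^ 2) / 4 = (-c) * (x : ℂ) ^ 2 / 4 by ring, div_pow, mul_pow]
  simp only [div_eq_mul_inv, mul_inv]
  field_simp

theorem theorem1 (lam lam' ξ ξ' γ ρ : ℂ) (a : ℕ) (α : ℝ) (μ p b c σ : ℂ)
    (hγ : 0 < γ.re) (hα : 0 < α) (hσ : σ ≠ 0)
    (hρ : max (max 0 (lam + lam' + ξ - γ).re) (lam' - ξ').re < (ρ + p + 1).re)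
    (x : ℝ) (hx : 0 < x) :
    (∀ t : ℝ, 0 < t → Summable (struveTerm a α μ p b c σ (t : ℂ))) ∧
    IntervalIntegrable
      (msmIntegrand lam lam' ξ ξ' γ
        (fun t : ℝ => (t : ℂ) ^ (ρ - 1) * generalizedStruve a α μ p b c σ (t : ℂ)) x)
      MeasureTheory.volume 0 x ∧
    Summable (foxWrightTerm (imageUpper lam lam' ξ ξ' γ ρ p)
      (imageLower lam lam' ξ ξ' γ ρ a α μ p b σ) (-(c * (x : ℂ) ^ 2) / 4)) ∧
    msmIntegral lam lam' ξ ξ' γ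
        (fun t : ℝ => (t : ℂ) ^ (ρ - 1) * generalizedStruve a α μ p b c σ (t : ℂ)) x =
      (x : ℂ) ^ (ρ + p - lam - lam' + γ) / (2 : ℂ) ^ (p + 1) *
        foxWright (imageUpper lam lam' ξ ξ' γ ρ p)
          (imageLower lam lam' ξ ξ' γ ρ a α μ p b σ) (-(c * (x : ℂ) ^ 2) / 4) := by
  have xc : (x : ℂ) ≠ 0 := by exact_mod_cast hx.ne'
  have h2 : (2 : ℂ) ^ (p + 1) ≠ 0 := by simp [Complex.cpow_eq_zero_iff]
  have hG : Complex.Gamma γ ≠ 0 := Complex.Gamma_ne_zero_of_re_pos hγ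
  set w := struveCoeff a α μ (p / σ + (b + 2) / 2) c with hw
  set f : ℝ → ℂ := fun t => (t : ℂ) ^ (ρ - 1) * generalizedStruve a α μ p b c σ (t : ℂ) with hf
  set K : ℂ → ℝ → ℂ := fun s =>
    msmIntegrand lam lam' ξ ξ' γ (fun t : ℝ => (t : ℂ) ^ (s - 1)) x with hK
  have hpos : ∀ k : ℕ, 0 < (ρ + p + 1 + 2 * k).re ∧
      0 < (ρ + p + 1 + 2 * k + γ - lam - lam' - ξ).re ∧
      0 < (ρ + p + 1 + 2 * k + ξ' - lam').re := by
    intro k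
    have hk : (0 : ℝ) ≤ k := k.cast_nonneg
    simp only [max_lt_iff, Complex.add_re, Complex.sub_re, Complex.mul_re, Complex.one_re,
      Complex.re_ofNat, Complex.im_ofNat, Complex.natCast_re, Complex.natCast_im] at hρ ⊢
    refine ⟨by linarith, by linarith, by linarith⟩
  have hKint := fun k : ℕ => msmIntegrand_cpow (lam := lam) hγ (hpos k).1 (hpos k).2.1
    (hpos k).2.2 hx
  have hK0 : IntegrableOn (K (ρ + p + 1)) (Set.Ioo 0 x) := by
    have := (hKint 0).1
    simpa only [Nat.cast_zero, mul_zero, add_zero] using this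
  -- Raising k only multiplies the integrand by t^(2k) ≤ x^(2k), so the integrability of the single
  -- function with k = 0 controls all terms.
  have hKpow : ∀ k : ℕ, ∀ t ∈ Set.Ioo 0 x,
      K (ρ + p + 1 + 2 * k) t = K (ρ + p + 1) t * ((t : ℂ) ^ 2) ^ k := by
    intro k t ht
    have tc : (t : ℂ) ≠ 0 := by exact_mod_cast ht.1.ne'
    simp only [hK, msmIntegrand]
    rw [show ρ + p + 1 + 2 * (k : ℂ) - 1 = (ρ + p + 1 - 1) + ((2 * k : ℕ) : ℂ) by
      push_cast; ring, Complex.cpow_add _ _ tc, Complex.cpow_natCast, pow_mul]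
    ring
  have hFint : ∀ k : ℕ, Integrable (fun t => w k * K (ρ + p + 1 + 2 * k) t)
      (volume.restrict (Set.Ioo 0 x)) := fun k => (hKint k).1.const_mul _
  have hFnorm : Summable fun k : ℕ =>
      ∫ t in Set.Ioo 0 x, ‖w k * K (ρ + p + 1 + 2 * k) t‖ := by
    refine .of_nonneg_of_le (fun k => integral_nonneg fun t => norm_nonneg _) (fun k => ?_)
      ((summable_struveCoeff a hα μ (p / σ + (b + 2) / 2) c (R := x ^ 2)
        (by positivity)).mul_right (∫ t in Set.Ioo 0 x, ‖K (ρ + p + 1) t‖))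
    rw [← integral_const_mul]
    refine setIntegral_mono_on (hFint k).norm (hK0.norm.const_mul _) measurableSet_Ioo
      fun t ht => ?_
    rw [hKpow k t ht, norm_mul, norm_mul, norm_pow, norm_pow, Complex.norm_real,
      Real.norm_of_nonneg ht.1.le]
    have h1 := ht.1.le
    have h2 := ht.2.le
    calc ‖w k‖ * (‖K (ρ + p + 1) t‖ * (t ^ 2) ^ k)
        ≤ ‖w k‖ * (‖K (ρ + p + 1) t‖ * (x ^ 2) ^ k) := by gcongr
      _ = _ := by ring
  have hpt : ∀ t ∈ Set.Ioo 0 x, HasSum (fun k : ℕ => w k * K (ρ + p + 1 + 2 * k) t)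
      ((2 : ℂ) ^ (p + 1) * msmIntegrand lam lam' ξ ξ' γ f x t) := fun t ht =>
    hasSum_msmIntegrand_struve lam lam' ξ ξ' γ ρ a hα μ p b c σ ht.1
  have hsum := hasSum_integral_of_summable_integral_norm hFint hFnorm
  have hint := integrable_tsum_of_summable_integral_norm hFint hFnorm
    ((ae_restrict_iff' measurableSet_Ioo).2 (ae_of_all _ fun t ht => (hpt t ht).summable))
  have hint' : IntegrableOn (fun t => (2 : ℂ) ^ (p + 1) * msmIntegrand lam lam' ξ ξ' γ f x t)
      (Set.Ioo 0 x) :=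
    (integrableOn_congr_fun (fun t ht => (hpt t ht).tsum_eq) measurableSet_Ioo).1 hint
  rw [setIntegral_congr_fun measurableSet_Ioo (fun t ht => (hpt t ht).tsum_eq),
    integral_const_mul] at hsum
  -- D collects everything independent of k. As D ≠ 0, summability of the integrated terms passes to
  -- the Fox–Wright series.
  set D : ℂ := (x : ℂ) ^ (ρ + p + γ - lam') * Complex.Gamma γ with hD
  have hD0 : D ≠ 0 := mul_ne_zero (by simp [Complex.cpow_eq_zero_iff, xc]) hG
  have hterm : ∀ k : ℕ, ∫ t in Set.Ioo 0 x, w k * K (ρ + p + 1 + 2 * k) t =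
      D * foxWrightTerm (imageUpper lam lam' ξ ξ' γ ρ p)
        (imageLower lam lam' ξ ξ' γ ρ a α μ p b σ) (-(c * (x : ℂ) ^ 2) / 4) k := by
    intro k
    rw [integral_const_mul, (hKint k).2, foxWrightTerm_image_eq,
      show ρ + p + 1 + 2 * (k : ℂ) + γ - lam' - 1 = (ρ + p + γ - lam') + ((2 * k : ℕ) : ℂ) by
        push_cast; ring, Complex.cpow_add _ _ xc, Complex.cpow_natCast, pow_mul]
    ring
  simp_rw [hterm] at hsum
  refine ⟨fun t ht => ?_, ?_, (summable_mul_left_iff hD0).1 hsum.summable, ?_⟩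
  · rw [funext (struveTerm_eq a α μ p b c σ ht)]
    exact (summable_struveCoeff_mul_pow a hα μ _ c _).mul_left _
  · rw [intervalIntegrable_iff_integrableOn_Ioo_of_le hx.le]
    refine (integrableOn_congr_fun (fun t _ => ?_) measurableSet_Ioo).1
      (hint'.const_mul ((2 : ℂ) ^ (p + 1))⁻¹)
    exact inv_mul_cancel_left₀ h2 _
  · have hval := hsum.tsum_eq
    rw [tsum_mul_left] at hval
    rw [msmIntegral, intervalIntegral.integral_of_le hx.le, integral_Ioc_eq_integral_Ioo, foxWright,
      show ρ + p - lam - lam' + γ = -lam + (ρ + p + γ - lam') by ring, Complex.cpow_add _ _ xc]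
    rw [div_mul_eq_mul_div, div_mul_eq_mul_div, div_eq_div_iff hG h2]
    rw [hD] at hval
    linear_combination -(x : ℂ) ^ (-lam) * hval
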